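/- **Conventions.** A function $\varepsilon:\mathbb N\to\mathbb R_{>0}$ is *negligible* if for every $c>0$ there is $N_c$ with $\varepsilon(n)<n^{-c}$ for all $n>N_c$. Let $n$ denote the security parameter. A *quantum polynomial-time oracle algorithm* $\mathcal A$ is a polynomial-time uniform family of quantum circuits (the description of the $n$-th circuit is computed from $1^n$ in polynomial time) over a fixed universal gate set together with query gates; it starts on the all-zero state and is measured in the computational basis at the end. For an oracle $O:\{0,1\}^a\to\{0,1\}^b$ a query gate acts by $|x,y\rangle\mapsto|x,y+O(x)\rangle$, where $+$ is the group operation of the answer register: either bitwise addition $\oplus$ or addition modulo $2^b$ (the theorem holds for either choice, made once and for all). A *quantum-secure pseudorandom function* is a keyed function $f:K\times X\to Y$, with $K=\{0,1\}^{\kappa(n)}$, $X=\{0,1\}^{\xi(n)}$, $Y=\{0,1\}^{\upsilon(n)}$ and $\kappa(n)\ge n$, such that $1^{\kappa(n)},1^{\xi(n)},1^{\upsilon(n)}$ are computable from $1^n$ in polynomial time, $(1^n,k,x)\mapsto f_k(x)$ is computable in polynomial time, and for every quantum polynomial-time oracle algorithm $\mathcal D$ there is a negligible function $\mathsf{negl}$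 such that for all $n$ $$\bigl|\Pr[\mathcal D^{f_k}(1^n)=1]-\Pr[\mathcal D^{g}(1^n)=1]\bigr|\le\mathsf{negl}(n),$$ where $k\in K$ and $g:X\to Y$ are uniformly random and the oracles are queried in superposition. A *message authentication code* (with deterministic tags) is a triple $(\mathsf{Gen},\mathsf{Mac},\mathsf{Vrfy})$ of polynomial-time algorithms, $\mathsf{Gen}$ being randomized, such that $\mathsf{Gen}(1^n)$ outputs a key $k$ with $|k|\ge n$, and $\mathsf{Vrfy}_k(m,t)=1$ if and only if $\mathsf{Mac}_k(m)=t$. It is *existentially unforgeable under quantum chosen-message attacks* (EUF-qCMA) if for every quantum polynomial-time oracle algorithm $\mathcal A$ there is a negligible function $\mathsf{negl}$ such that for all $n$, when $k$ is generated by $\mathsf{Gen}(1^n)$ and $\mathcal A(1^n)$ is given quantum oracle access to $\mathsf{Mac}_k$, the probability that $\mathcal A$ outputs $q+1$ distinct pairs $(m,t)$ that all satisfy $\mathsf{Vrfy}_k(m,t)=1$ is at most $\mathsf{negl}(n)$; here $q=q(n)$ is the number of oracle queries made by $\mathcal A$. **Theorem.** Let $f:K\times X\to Y$ be a quantum-secure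 pseudorandom function such that $1/|Y|$ is negligible in the security parameter $n$. Let $\mathsf{Gen}(1^n)$ output a uniformly random $k\in K$, let $\mathsf{Mac}_k(m)=f_k(m)$ for $m\in X$, and let $\mathsf{Vrfy}_k(m,t)=1$ if and only if $f_k(m)=t$. Then $(\mathsf{Gen},\mathsf{Mac},\mathsf{Vrfy})$ is a message authentication code, and it is EUF-qCMA secure. -/

import Mathlib

namespace QMac

noncomputable section

/-! ### Negligible functions -/

/-- A function `ε : ℕ → ℝ_{>0}` is negligible if it decreases faster than any inverse polynomial. -/
def IsNegligible (ε : ℕ → ℝ) : Prop :=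
  (∀ n, 0 < ε n) ∧ ∀ c : ℕ, 0 < c → ∃ N : ℕ, ∀ n : ℕ, N < n → ε n < 1 / (n : ℝ) ^ c

/-! ### Classical polynomial time

The machine model is the multi-stack machine over the alphabet `{0, 1}`, with structured control:
a program works on finitely many of the stacks `0, 1, 2, …`, and its steps are counted. -/

/-- Programs of a machine with stacks of bits. -/
inductive Prog : Type
  /-- push the bit `b` on stack `r` -/
  | push (r : ℕ) (b : Bool)
  /-- remove the top of stack `r` (if there is one) -/
  | pop (r : ℕ)
  /-- overwrite stack `dst` by the content of stack `src` -/
  | copy (dst src : ℕ)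
  /-- run `p`, then `q` -/
  | seq (p q : Prog)
  /-- run `pNil`, `pFalse` or `pTrue` according to whether stack `r` is empty, has top `0`, or has
  top `1` -/
  | branch (r : ℕ) (pNil pFalse pTrue : Prog)
  /-- while stack `r` is nonempty, run `p` -/
  | loop (r : ℕ) (p : Prog)

/-- The contents of all stacks, the top of a stack being the head of the list. -/
abbrev Store : Type := ℕ → List Bool

/-- `Runs p σ t τ`: started on `σ`, the program `p` halts after exactly `t` elementary steps, with
stacks `τ`. Copying a stack costs as many steps as the stack is high, plus one. -/
inductive Runs : Prog → Store → ℕ → Store → Prop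
  | push (r : ℕ) (b : Bool) (σ : Store) :
      Runs (.push r b) σ 1 (Function.update σ r (b :: σ r))
  | pop (r : ℕ) (σ : Store) :
      Runs (.pop r) σ 1 (Function.update σ r (σ r).tail)
  | copy (dst src : ℕ) (σ : Store) :
      Runs (.copy dst src) σ ((σ src).length + 1) (Function.update σ dst (σ src))
  | seq {p q : Prog} {σ τ ρ : Store} {s t : ℕ} :
      Runs p σ s τ → Runs q τ t ρ → Runs (.seq p q) σ (s + t) ρ
  | branchNil {r : ℕ} {pNil pFalse pTrue : Prog} {σ τ : Store} {t : ℕ} :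
      σ r = [] → Runs pNil σ t τ → Runs (.branch r pNil pFalse pTrue) σ (t + 1) τ
  | branchFalse {r : ℕ} {pNil pFalse pTrue : Prog} {σ τ : Store} {t : ℕ} {l : List Bool} :
      σ r = false :: l → Runs pFalse σ t τ → Runs (.branch r pNil pFalse pTrue) σ (t + 1) τ
  | branchTrue {r : ℕ} {pNil pFalse pTrue : Prog} {σ τ : Store} {t : ℕ} {l : List Bool} :
      σ r = true :: l → Runs pTrue σ t τ → Runs (.branch r pNil pFalse pTrue) σ (t + 1) τ
  | loopDone {r : ℕ} {p : Prog} {σ : Store} :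
      σ r = [] → Runs (.loop r p) σ 1 σ
  | loopStep {r : ℕ} {p : Prog} {σ τ ρ : Store} {s t : ℕ} :
      σ r ≠ [] → Runs p σ s τ → Runs (.loop r p) τ t ρ → Runs (.loop r p) σ (s + t + 1) ρ

/-- The inputs are written on the first stacks; all other stacks are empty. -/
def initStore (inputs : List (List Bool)) : Store := fun r => inputs.getD r []

/-- One program computes, for every `i`, the bit string `out i` (left on stack `0`) from the bit
strings `inp i`, in a number of steps that is polynomial in the total length of `inp i`. -/
def PolyTime {ι : Type} (inp : ι → List (List Bool)) (out : ι → List Bool) : Prop :=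
  ∃ (p : Prog) (time : Polynomial ℕ), ∀ i : ι, ∃ (t : ℕ) (τ : Store),
    Runs p (initStore (inp i)) t τ ∧ τ 0 = out i ∧
      t ≤ time.eval ((inp i).map List.length).sum

/-- The string `1ⁿ`. -/
def ones (n : ℕ) : List Bool := List.replicate n true

/-- A bit vector as a list of bits, least significant bit first. -/
def bits {w : ℕ} (v : BitVec w) : List Bool := List.ofFn fun i : Fin w => v.getLsb i

/-- A length function is efficiently computable if `1ⁿ ↦ 1^(ℓ n)` is. -/
def PolyTimeLength (ℓ : ℕ → ℕ) : Prop :=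
  PolyTime (fun n : ℕ => [ones n]) (fun n => ones (ℓ n))

/-! ### Quantum circuits with query gates

The wires are numbered `0, 1, 2, …`, and all of them initially hold `|0⟩`; every circuit acts on
finitely many wires. A computational basis state is given by the finite set of the wires that hold
`1`. -/

/-- How an oracle adds its answer to the answer register: bitwise, or modulo `2 ^ b`. -/
inductive QueryConvention : Type
  | xor
  | addMod

/-- The group operation of the answer register. -/
def QueryConvention.combine {b : ℕ} : QueryConvention → BitVec b → BitVec b → BitVec b
  | .xor, y, z => y ^^^ z
  | .addMod, y, z => y + z

/-- The gates: `X`, Hadamard, `T = diag(1, e^{iπ/4})`, controlled-not, Toffoli, and a query to an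
oracle `{0,1}^a → {0,1}^b` with query register `x` and answer register `y`. -/
inductive Gate (a b : ℕ) : Type
  | X (w : ℕ)
  | H (w : ℕ)
  | T (w : ℕ)
  | CNOT (c t : ℕ) (h : c ≠ t)
  | CCNOT (c d t : ℕ) (hcd : c ≠ d) (hct : c ≠ t) (hdt : d ≠ t)
  | query (x : Fin a ↪ ℕ) (y : Fin b ↪ ℕ) (h : ∀ i j, x i ≠ y j)

/-- A circuit is a list of gates, the first gate being applied first. -/
abbrev Circuit (a b : ℕ) : Type := List (Gate a b)

/-- State vectors: amplitudes of basis states. -/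
abbrev State : Type := Finset ℕ →₀ ℂ

/-- The content of a register in a basis state. -/
def readReg {w : ℕ} (S : Finset ℕ) (r : Fin w → ℕ) : BitVec w :=
  BitVec.ofFnLE fun i => decide (r i ∈ S)

/-- Overwriting the content of a register in a basis state. -/
def writeReg {w : ℕ} (S : Finset ℕ) (r : Fin w ↪ ℕ) (v : BitVec w) : Finset ℕ :=
  (S \ Finset.univ.map r) ∪ (Finset.univ.filter fun i => v.getLsb i = true).map r

/-- The basis state with wire `w` flipped. -/
def flipWire (S : Finset ℕ) (w : ℕ) : Finset ℕ := symmDiff S {w}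

/-- The image of the basis state `S` under a gate, when the oracle is `f`. -/
def Gate.onBasis {a b : ℕ} (conv : QueryConvention) (f : BitVec a → BitVec b) :
    Gate a b → Finset ℕ → State
  | .X w, S => Finsupp.single (flipWire S w) 1
  | .H w, S => ((1 / Real.sqrt 2 : ℝ) : ℂ) •
      (Finsupp.single (S.erase w) 1 + Finsupp.single (insert w S) (if w ∈ S then -1 else 1))
  | .T w, S => Finsupp.single S (if w ∈ S then Complex.exp (Complex.I * Real.pi / 4) else 1)
  | .CNOT c t _, S => Finsupp.single (if c ∈ S then flipWire S t else S) 1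
  | .CCNOT c d t _ _ _, S => Finsupp.single (if c ∈ S ∧ d ∈ S then flipWire S t else S) 1
  | .query x y _, S =>
      Finsupp.single (writeReg S y (conv.combine (readReg S y) (f (readReg S x)))) 1

/-- The action of a gate on state vectors, by linearity. -/
def Gate.apply {a b : ℕ} (conv : QueryConvention) (f : BitVec a → BitVec b) (g : Gate a b)
    (ψ : State) : State :=
  ψ.sum fun S α => α • g.onBasis conv f S

/-- The final state of a circuit, when the oracle is `f`. -/
def finalState {a b : ℕ} (conv : QueryConvention) (f : BitVec a → BitVec b) (C : Circuit a b) :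
    State :=
  C.foldl (fun ψ g => g.apply conv f ψ) (Finsupp.single ∅ 1)

open Classical in
/-- The probability that measuring all wires at the end, in the computational basis, gives an
outcome in `E`. -/
def outcomeProb {a b : ℕ} (conv : QueryConvention) (f : BitVec a → BitVec b) (C : Circuit a b)
    (E : Finset ℕ → Prop) : ℝ :=
  (finalState conv f C).sum fun S α => if E S then ‖α‖ ^ 2 else 0

/-- Is this gate a query gate? -/
def Gate.isQuery {a b : ℕ} : Gate a b → Bool
  | .query _ _ _ => true
  | _ => false

/-- The number of query gates. -/
def queryCount {a b : ℕ} (C : Circuit a b) : ℕ := C.countP Gate.isQuery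

/-- Self-delimiting unary code of a number. -/
def natCode (m : ℕ) : List Bool := ones m ++ [false]

/-- Description of a gate: its type, followed by its wires. -/
def Gate.code {a b : ℕ} : Gate a b → List Bool
  | .X w => natCode 0 ++ natCode w
  | .H w => natCode 1 ++ natCode w
  | .T w => natCode 2 ++ natCode w
  | .CNOT c t _ => natCode 3 ++ natCode c ++ natCode t
  | .CCNOT c d t _ _ _ => natCode 4 ++ natCode c ++ natCode d ++ natCode t
  | .query x y _ => natCode 5 ++ (List.ofFn fun i => natCode (x i)).flatten ++
      (List.ofFn fun j => natCode (y j)).flatten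

/-- Description of a circuit: the number of its query gates, followed by its gates in order. -/
def circuitCode {a b : ℕ} (C : Circuit a b) : List Bool :=
  natCode (queryCount C) ++ (C.map Gate.code).flatten

/-- A quantum polynomial-time algorithm with quantum access to an oracle
`{0,1}^(a n) → {0,1}^(b n)`: a uniform family of quantum circuits, i.e. the description of the
`n`-th circuit is computed from `1ⁿ` in polynomial time. -/
structure QPTAlgorithm (a b : ℕ → ℕ) where
  circuit : ∀ n, Circuit (a n) (b n)
  uniform : PolyTime (fun n : ℕ => [ones n]) (fun n => circuitCode (circuit n))

/-! ### Quantum pseudorandom functions -/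

/-- A keyed function `f : K × X → Y`: for every security parameter `n` it maps a key in
`K = {0,1}^(keyLen n)` and an argument in `X = {0,1}^(inLen n)` to a value in
`Y = {0,1}^(outLen n)`. -/
structure KeyedFunction where
  keyLen : ℕ → ℕ
  inLen : ℕ → ℕ
  outLen : ℕ → ℕ
  eval : ∀ n, BitVec (keyLen n) → BitVec (inLen n) → BitVec (outLen n)

/-- `f` is efficient: the lengths are efficiently computable, keys have at least the length of the
security parameter, and `(1ⁿ, k, x) ↦ f_k(x)` is computable in polynomial time. -/
def KeyedFunction.IsEfficient (f : KeyedFunction) : Prop :=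
  PolyTimeLength f.keyLen ∧ PolyTimeLength f.inLen ∧ PolyTimeLength f.outLen ∧
  (∀ n, n ≤ f.keyLen n) ∧
  PolyTime
    (fun i : (n : ℕ) × BitVec (f.keyLen n) × BitVec (f.inLen n) =>
      [ones i.1, bits i.2.1, bits i.2.2])
    (fun i => bits (f.eval i.1 i.2.1 i.2.2))

/-- `Pr[D^{f_k}(1ⁿ) = 1]`, for a uniformly random key `k`; the output bit of `D` is wire `0`. -/
def KeyedFunction.realProb (conv : QueryConvention) (f : KeyedFunction)
    (D : QPTAlgorithm f.inLen f.outLen) (n : ℕ) : ℝ :=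
  (∑ k : BitVec (f.keyLen n), outcomeProb conv (f.eval n k) (D.circuit n) fun S => 0 ∈ S) /
    Fintype.card (BitVec (f.keyLen n))

/-- `Pr[D^g(1ⁿ) = 1]`, for a uniformly random function `g : X → Y`. -/
def KeyedFunction.idealProb (conv : QueryConvention) (f : KeyedFunction)
    (D : QPTAlgorithm f.inLen f.outLen) (n : ℕ) : ℝ :=
  (∑ g : BitVec (f.inLen n) → BitVec (f.outLen n),
      outcomeProb conv g (D.circuit n) fun S => 0 ∈ S) /
    Fintype.card (BitVec (f.inLen n) → BitVec (f.outLen n))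

/-- Quantum-secure pseudorandom functions. -/
def KeyedFunction.IsQuantumPRF (conv : QueryConvention) (f : KeyedFunction) : Prop :=
  f.IsEfficient ∧
  ∀ D : QPTAlgorithm f.inLen f.outLen, ∃ negl : ℕ → ℝ, IsNegligible negl ∧
    ∀ n, |f.realProb conv D n - f.idealProb conv D n| ≤ negl n

/-! ### Message authentication codes -/

/-- The algorithms `(Gen, Mac, Vrfy)` of a message authentication code with deterministic tags.
`Gen` is randomized; it draws `coinLen n` uniformly random bits. -/
structure MAC where
  coinLen : ℕ → ℕ
  keyLen : ℕ → ℕ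
  msgLen : ℕ → ℕ
  tagLen : ℕ → ℕ
  gen : ∀ n, BitVec (coinLen n) → BitVec (keyLen n)
  mac : ∀ n, BitVec (keyLen n) → BitVec (msgLen n) → BitVec (tagLen n)
  vrfy : ∀ n, BitVec (keyLen n) → BitVec (msgLen n) → BitVec (tagLen n) → Bool

/-- The three algorithms run in polynomial time, keys have at least the length of the security
parameter, and verification is correct. -/
structure MAC.IsMAC (M : MAC) : Prop where
  coinLen_polyTime : PolyTimeLength M.coinLen
  gen_polyTime : PolyTime
    (fun i : (n : ℕ) × BitVec (M.coinLen n) => [ones i.1, bits i.2])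
    (fun i => bits (M.gen i.1 i.2))
  mac_polyTime : PolyTime
    (fun i : (n : ℕ) × BitVec (M.keyLen n) × BitVec (M.msgLen n) =>
      [ones i.1, bits i.2.1, bits i.2.2])
    (fun i => bits (M.mac i.1 i.2.1 i.2.2))
  vrfy_polyTime : PolyTime
    (fun i : (n : ℕ) × BitVec (M.keyLen n) × BitVec (M.msgLen n) × BitVec (M.tagLen n) =>
      [ones i.1, bits i.2.1, bits i.2.2.1, bits i.2.2.2])
    (fun i => [M.vrfy i.1 i.2.1 i.2.2.1 i.2.2.2])
  le_keyLen : ∀ n, n ≤ M.keyLen n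
  correct : ∀ n k m t, M.vrfy n k m t = true ↔ M.mac n k m = t

/-- The `i`-th of the `p` message-tag pairs in a measurement outcome: the first `p * a` wires hold
the messages and the next `p * b` wires hold the tags. -/
def outputPair (a b p : ℕ) (S : Finset ℕ) (i : Fin p) : BitVec a × BitVec b :=
  (readReg S fun j : Fin a => i.val * a + j.val,
   readReg S fun j : Fin b => p * a + i.val * b + j.val)

/-- The outcome `S` consists of `p` distinct message-tag pairs, all valid under the key `k`. -/
def MAC.Forged (M : MAC) (n : ℕ) (k : BitVec (M.keyLen n)) (p : ℕ) (S : Finset ℕ) : Prop :=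
  Function.Injective (outputPair (M.msgLen n) (M.tagLen n) p S) ∧
  ∀ i : Fin p, M.vrfy n k (outputPair (M.msgLen n) (M.tagLen n) p S i).1
    (outputPair (M.msgLen n) (M.tagLen n) p S i).2 = true

/-- The probability that `A` wins the quantum MAC-forge game: with a key from `Gen(1ⁿ)` and quantum
access to `Mac_k`, it outputs `q + 1` distinct valid pairs, `q` being the number of its queries. -/
def MAC.forgeProb (conv : QueryConvention) (M : MAC) (A : QPTAlgorithm M.msgLen M.tagLen)
    (n : ℕ) : ℝ :=
  (∑ r : BitVec (M.coinLen n),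
      outcomeProb conv (M.mac n (M.gen n r)) (A.circuit n)
        (M.Forged n (M.gen n r) (queryCount (A.circuit n) + 1))) /
    Fintype.card (BitVec (M.coinLen n))

/-- Existential unforgeability under quantum chosen-message attacks. -/
def MAC.IsEUFqCMA (conv : QueryConvention) (M : MAC) : Prop :=
  ∀ A : QPTAlgorithm M.msgLen M.tagLen, ∃ negl : ℕ → ℝ, IsNegligible negl ∧
    ∀ n, M.forgeProb conv A n ≤ negl n

/-- The code with `Mac_k(m) = f_k(m)`: the key is uniformly random, and a tag is verified by
recomputing it. -/
def KeyedFunction.toMAC (f : KeyedFunction) : MAC where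
  coinLen := f.keyLen
  keyLen := f.keyLen
  msgLen := f.inLen
  tagLen := f.outLen
  gen := fun _ r => r
  mac := f.eval
  vrfy := fun n k m t => decide (f.eval n k m = t)

end

end QMac

/-! Let a forger make `q` queries. A distinguisher runs it and checks the `q + 1` claimed pairs by
asking its oracle for the tags. The check is a classical reversible circuit with fresh work wires,
so it only postprocesses the measured outcome, and the distinguisher accepts with exactly the
probability of a forgery (`outcomeProb_distinguisher`). By pseudorandomness it remains to bound the
success of the forger against a uniformly random `H : X → Y` by `(q + 1) / |Y|`; this is negligible
because `q` is polynomially bounded.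

The bound is a form of the polynomial method. For a fixed outcome, the amplitude as a function of
`H` is a combination of functions each depending on at most `q` values of `H`
(`finalState_mem_localFun`): a query adds one value, and the other gates are linear maps independent
of `H`. Suppose the outcome claims the values `t` on a set `M` of `q + 1` points, and freeze `H`
outside `M`. Each function of the combination misses a point of `M`, so the amplitude is orthogonal
to `w = ∏ (1_{t x} - 1/|Y|)`, and its value at `t` is its inner product with `δ_t - w`. Since `‖w‖²
= w(t) = (1 - 1/|Y|)^(q+1)`, one gets `‖δ_t - w‖² = 1 - (1 - 1/|Y|)^(q+1) ≤ (q + 1)/|Y|`, and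
Cauchy–Schwarz yields `norm_sq_apply_le` and `sum_norm_sq_le`. Summed over all outcomes, the weights
are `1` for every `H` by unitarity, which gives `sum_outcomeProb_le`.

The remaining work is uniformity of the distinguisher. Descriptions write wires in unary, so the
length `L` of the forger's description lies above all its wires, and the work space can start beyond
`L`. The verifier is then a family of nested loops over wire numbers polynomial in `q`, `a`, `b`,
`L` and the loop counters. A small printing language (`Expr`, `Text`) is compiled to polynomial-time
stack programs in `Text.prog_triple`, and `polyTime_extend` appends the printed text to the
description of the forger. -/

namespace QMac

/-! ### Reasoning about programs -/

/-- Renaming the stacks of a program. -/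
def Prog.map (f : ℕ → ℕ) : Prog → Prog
  | .push r b => .push (f r) b
  | .pop r => .pop (f r)
  | .copy d s => .copy (f d) (f s)
  | .seq p q => .seq (p.map f) (q.map f)
  | .branch r p q s => .branch (f r) (p.map f) (q.map f) (s.map f)
  | .loop r p => .loop (f r) (p.map f)

theorem update_renamed {f : ℕ → ℕ} (hf : Function.Injective f) {σ σ' : Store}
    (h : ∀ r, σ' (f r) = σ r) (r : ℕ) (l : List Bool) :
    (∀ s, Function.update σ' (f r) l (f s) = Function.update σ r l s) ∧
      ∀ s, s ∉ Set.range f → Function.update σ' (f r) l s = σ' s := by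
  refine ⟨fun s => ?_, fun s hs => ?_⟩
  · by_cases hsr : s = r
    · subst hsr; simp
    · rw [Function.update_of_ne (fun e => hsr (hf e)), Function.update_of_ne hsr, h]
  · exact Function.update_of_ne (fun e => hs ⟨r, e.symm⟩) _ _

/-- A renamed program runs as the original one, and does not touch the other stacks. -/
theorem Runs.map {f : ℕ → ℕ} (hf : Function.Injective f) {p : Prog} {σ τ : Store} {t : ℕ}
    (hr : Runs p σ t τ) : ∀ σ' : Store, (∀ r, σ' (f r) = σ r) →
      ∃ τ' : Store, Runs (p.map f) σ' t τ' ∧ (∀ r, τ' (f r) = τ r) ∧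
        ∀ s, s ∉ Set.range f → τ' s = σ' s := by
  induction hr with
  | push r b σ =>
    intro σ' h
    refine ⟨_, Runs.push (f r) b σ', ?_⟩
    rw [h]; exact update_renamed hf h _ _
  | pop r σ =>
    intro σ' h
    refine ⟨_, Runs.pop (f r) σ', ?_⟩
    rw [h]; exact update_renamed hf h _ _
  | copy d s σ =>
    intro σ' h
    refine ⟨_, h s ▸ Runs.copy (f d) (f s) σ', ?_⟩
    exact update_renamed hf h _ _
  | seq _ _ ih1 ih2 =>
    intro σ' h
    obtain ⟨τ1, r1, e1, o1⟩ := ih1 σ' h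
    obtain ⟨τ2, r2, e2, o2⟩ := ih2 τ1 e1
    exact ⟨τ2, r1.seq r2, e2, fun s hs => (o2 s hs).trans (o1 s hs)⟩
  | branchNil h0 _ ih =>
    intro σ' h
    obtain ⟨τ1, r1, e1, o1⟩ := ih σ' h
    exact ⟨τ1, Runs.branchNil ((h _).trans h0) r1, e1, o1⟩
  | branchFalse h0 _ ih =>
    intro σ' h
    obtain ⟨τ1, r1, e1, o1⟩ := ih σ' h
    exact ⟨τ1, Runs.branchFalse ((h _).trans h0) r1, e1, o1⟩
  | branchTrue h0 _ ih =>
    intro σ' h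
    obtain ⟨τ1, r1, e1, o1⟩ := ih σ' h
    exact ⟨τ1, Runs.branchTrue ((h _).trans h0) r1, e1, o1⟩
  | loopDone h0 =>
    intro σ' h
    exact ⟨σ', Runs.loopDone ((h _).trans h0), h, fun _ _ => rfl⟩
  | loopStep h0 _ _ ih1 ih2 =>
    intro σ' h
    obtain ⟨τ1, r1, e1, o1⟩ := ih1 σ' h
    obtain ⟨τ2, r2, e2, o2⟩ := ih2 τ1 e1
    exact ⟨τ2, Runs.loopStep (by rwa [h]) r1 r2, e2, fun s hs => (o2 s hs).trans (o1 s hs)⟩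

/-- In every step a stack gets higher by at most one, or becomes a copy of another one. -/
theorem Runs.length_le {p : Prog} {σ τ : Store} {t : ℕ} (hr : Runs p σ t τ) :
    ∀ m, (∀ r, (σ r).length ≤ m) → ∀ r, (τ r).length ≤ m + t := by
  induction hr with
  | push r b σ =>
    intro m h s
    by_cases hs : s = r
    · subst hs; simp [h]
    · rw [Function.update_of_ne hs]; exact (h s).trans (by omega)
  | pop r σ =>
    intro m h s
    by_cases hs : s = r
    · subst hs; simp only [Function.update_self, List.length_tail]; have := h s; omega
    · rw [Function.update_of_ne hs]; exact (h s).trans (by omega)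
  | copy d s σ =>
    intro m h r
    by_cases hs : r = d
    · subst hs; simp only [Function.update_self]; have := h s; omega
    · rw [Function.update_of_ne hs]; exact (h r).trans (by omega)
  | seq _ _ ih1 ih2 => intro m h r; have := ih2 _ (ih1 m h) r; omega
  | branchNil _ _ ih => intro m h r; have := ih m h r; omega
  | branchFalse _ _ ih => intro m h r; have := ih m h r; omega
  | branchTrue _ _ ih => intro m h r; have := ih m h r; omega
  | loopDone _ => intro m h r; have := h r; omega
  | loopStep _ _ _ ih1 ih2 => intro m h r; have := ih2 _ (ih1 m h) r; omega

/-! ### Hoare triples with time bounds -/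

/-- Started on `σ`, the program halts within `T` steps, in a store that satisfies `Q`. -/
def Triple (p : Prog) (σ : Store) (T : ℕ) (Q : Store → Prop) : Prop :=
  ∃ t τ, t ≤ T ∧ Runs p σ t τ ∧ Q τ

namespace Triple

variable {p q : Prog} {σ : Store} {S T : ℕ} {Q R : Store → Prop}

theorem mono (h : Triple p σ S Q) (hST : S ≤ T) (hQR : ∀ τ, Q τ → R τ) : Triple p σ T R :=
  let ⟨t, τ, ht, hr, hq⟩ := h
  ⟨t, τ, ht.trans hST, hr, hQR τ hq⟩

theorem seq (h : Triple p σ S fun τ => Triple q τ T Q) : Triple (.seq p q) σ (S + T) Q :=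
  let ⟨_, _, ht, hr, _, ρ, hs, hr', hq⟩ := h
  ⟨_, ρ, Nat.add_le_add ht hs, hr.seq hr', hq⟩

theorem push {r : ℕ} {b : Bool} (h : Q (Function.update σ r (b :: σ r))) :
    Triple (.push r b) σ 1 Q :=
  ⟨1, _, le_rfl, Runs.push r b σ, h⟩

theorem pop {r : ℕ} (h : Q (Function.update σ r (σ r).tail)) : Triple (.pop r) σ 1 Q :=
  ⟨1, _, le_rfl, Runs.pop r σ, h⟩

theorem copy {d s : ℕ} (hT : (σ s).length + 1 ≤ T) (h : Q (Function.update σ d (σ s))) :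
    Triple (.copy d s) σ T Q :=
  ⟨_, _, hT, Runs.copy d s σ, h⟩

theorem branchFalse {r : ℕ} {p₀ p₁ : Prog} {l : List Bool} (h0 : σ r = false :: l)
    (h : Triple p σ T Q) : Triple (.branch r p₀ p p₁) σ (T + 1) Q :=
  let ⟨_, τ, ht, hr, hq⟩ := h
  ⟨_, τ, Nat.add_le_add_right ht 1, Runs.branchFalse h0 hr, hq⟩

theorem branchTrue {r : ℕ} {p₀ p₁ : Prog} {l : List Bool} (h0 : σ r = true :: l)
    (h : Triple p σ T Q) : Triple (.branch r p₀ p₁ p) σ (T + 1) Q :=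
  let ⟨_, τ, ht, hr, hq⟩ := h
  ⟨_, τ, Nat.add_le_add_right ht 1, Runs.branchTrue h0 hr, hq⟩

theorem branchNil {r : ℕ} {p₀ p₁ : Prog} (h0 : σ r = [])
    (h : Triple p σ T Q) : Triple (.branch r p p₀ p₁) σ (T + 1) Q :=
  let ⟨_, τ, ht, hr, hq⟩ := h
  ⟨_, τ, Nat.add_le_add_right ht 1, Runs.branchNil h0 hr, hq⟩

/-- A loop with an invariant `I` that says how often the body is still to be run. -/
theorem loop {r : ℕ} (I : ℕ → Store → Prop) (h0 : ∀ σ, I 0 σ → σ r = [])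
    (h1 : ∀ m σ, I (m + 1) σ → σ r ≠ []) (hstep : ∀ m σ, I (m + 1) σ → Triple p σ T (I m)) :
    ∀ N σ, I N σ → Triple (.loop r p) σ (N * (T + 1) + 1) (I 0) := by
  intro N
  induction N with
  | zero => intro σ h; exact ⟨1, σ, by simp, Runs.loopDone (h0 σ h), h⟩
  | succ m ih =>
    intro σ h
    obtain ⟨t, τ, ht, hr, hτ⟩ := hstep m σ h
    obtain ⟨s, ρ, hs, hr', hρ⟩ := ih τ hτ
    refine ⟨_, ρ, ?_, Runs.loopStep (h1 m σ h) hr hr', hρ⟩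
    rw [Nat.succ_mul]; omega

/-- A loop whose counter is not otherwise used by the invariant. -/
theorem loop_list {r : ℕ} (I : List Bool → Store → Prop) (hr : ∀ l σ, I l σ → σ r = l)
    (hstep : ∀ b l σ, I (b :: l) σ → Triple p σ T (I l)) :
    ∀ l σ, I l σ → Triple (.loop r p) σ (l.length * (T + 1) + 1) (I []) := by
  intro l
  induction l with
  | nil => intro σ h; exact ⟨1, σ, by simp, Runs.loopDone (hr [] σ h), h⟩
  | cons b l ih =>
    intro σ h
    obtain ⟨t, τ, ht, hr1, hτ⟩ := hstep b l σ h
    obtain ⟨s, ρ, hs, hr', hρ⟩ := ih τ hτ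
    refine ⟨_, ρ, ?_, Runs.loopStep (by rw [hr _ _ h]; simp) hr1 hr', hρ⟩
    rw [List.length_cons, Nat.succ_mul]; omega

theorem map {f : ℕ → ℕ} (hf : Function.Injective f) {σ' : Store} (h : Triple p σ T Q)
    (hσ : ∀ r, σ' (f r) = σ r)
    (hQ : ∀ τ τ' : Store, Q τ → (∀ r, τ' (f r) = τ r) → (∀ s, s ∉ Set.range f → τ' s = σ' s) →
      R τ') : Triple (p.map f) σ' T R := by
  obtain ⟨t, τ, ht, hr, hq⟩ := h
  obtain ⟨τ', hr', h1, h2⟩ := hr.map hf σ' hσ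
  exact ⟨t, τ', ht, hr', hQ τ τ' hq h1 h2⟩

end Triple

theorem polyTime_of_triple {ι : Type} {inp : ι → List (List Bool)} {out : ι → List Bool}
    (p : Prog) (time : Polynomial ℕ)
    (h : ∀ i, Triple p (initStore (inp i)) (time.eval ((inp i).map List.length).sum)
      fun τ => τ 0 = out i) : PolyTime inp out :=
  ⟨p, time, fun i => let ⟨t, τ, ht, hr, hq⟩ := h i; ⟨t, τ, hr, hq, ht⟩⟩

theorem PolyTime.triple {ι : Type} {inp : ι → List (List Bool)} {out : ι → List Bool}
    (h : PolyTime inp out) : ∃ (p : Prog) (time : Polynomial ℕ), ∀ i,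
      Triple p (initStore (inp i)) (time.eval ((inp i).map List.length).sum) fun τ => τ 0 = out i :=
  let ⟨p, time, h⟩ := h
  ⟨p, time, fun i => let ⟨t, τ, hr, hq, ht⟩ := h i; ⟨t, τ, ht, hr, hq⟩⟩

/-- Coefficients in `ℕ` make every time bound monotone. -/
theorem eval_le_eval (P : Polynomial ℕ) {m n : ℕ} (h : m ≤ n) : P.eval m ≤ P.eval n := by
  rw [Polynomial.eval_eq_sum_range, Polynomial.eval_eq_sum_range]
  exact Finset.sum_le_sum fun i _ => Nat.mul_le_mul_left _ (Nat.pow_le_pow_left h i)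

/-- The length of a polynomial-time output is polynomially bounded. -/
theorem PolyTime.length_le {ι : Type} {inp : ι → List (List Bool)} {out : ι → List Bool}
    (h : PolyTime inp out) : ∃ P : Polynomial ℕ, ∀ i,
      (out i).length ≤ P.eval ((inp i).map List.length).sum := by
  obtain ⟨p, time, h⟩ := h
  -- No stack starts higher than the total input length, which accounts for `X`, and the maximal
  -- height grows by at most one per time step.
  refine ⟨time + Polynomial.X, fun i => ?_⟩
  obtain ⟨t, τ, hr, hq, ht⟩ := h i
  have := hr.length_le ((inp i).map List.length).sum (fun r => ?_) 0
  · rw [← hq]; simp only [Polynomial.eval_add, Polynomial.eval_X]; omega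
  · unfold initStore
    by_cases hr : r < (inp i).length
    · rw [List.getD_eq_getElem _ _ hr]
      exact List.le_sum_of_mem (List.mem_map_of_mem (List.getElem_mem hr))
    · rw [List.getD_eq_default _ _ (by omega)]; simp

@[simp] theorem length_ones (n : ℕ) : (ones n).length = n := List.length_replicate

@[simp] theorem length_bits {w : ℕ} (v : BitVec w) : (bits v).length = w := by simp [bits]

theorem ones_succ (n : ℕ) : ones (n + 1) = true :: ones n := rfl

theorem bits_injective {w : ℕ} : Function.Injective (bits (w := w)) := by
  intro u v h
  have := List.ofFn_injective h
  apply BitVec.eq_of_getLsbD_eq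
  intro i hi
  exact congrFun this ⟨i, hi⟩

/-! ### The keyed function as a message authentication code -/

/-- Empties the stacks `0` and `3`, and makes stack `5` nonempty if they differed. -/
def compareProg : Prog :=
  .loop 0 <| .seq
    (.branch 0 (.pop 0)
      (.branch 3 (.pop 3) (.pop 3) (.seq (.push 5 true) (.pop 3)))
      (.branch 3 (.pop 3) (.seq (.push 5 true) (.pop 3)) (.pop 3)))
    (.pop 0)

/-- The invariant is that "no mismatch recorded and equal remainders" stays equivalent to `u = v`.
Equal lengths make both stacks run out together. -/
theorem compareProg_triple (u v : List Bool) (huv : u.length = v.length) (σ : Store)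
    (h0 : σ 0 = u) (h3 : σ 3 = v) (h5 : σ 5 = []) :
    Triple compareProg σ (u.length * 6 + 1) fun τ => τ 0 = [] ∧ (τ 5 = [] ↔ u = v) := by
  refine (Triple.loop_list (T := 5) (fun l τ => τ 0 = l ∧ (τ 3).length = l.length ∧
      ((τ 5 = [] ∧ l = τ 3) ↔ u = v)) (fun _ _ h => h.1) ?_ u σ
      ⟨h0, by rw [h3, huv], by simp [h5, h3]⟩).mono le_rfl ?_
  · rintro b l σ ⟨e0, e3, e5⟩
    obtain ⟨c, l', hl'⟩ : ∃ c l', σ 3 = c :: l' := by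
      cases h : σ 3 with
      | nil => simp [h] at e3
      | cons c l' => exact ⟨c, l', rfl⟩
    rw [hl'] at e3 e5
    have e3' : l'.length = l.length := by simpa using e3
    refine Triple.seq (S := 4) (T := 1) ?_
    cases b <;> cases c
    · refine (Triple.branchFalse e0 <| Triple.branchFalse hl' <| Triple.pop <| Triple.pop ?_).mono
        (by norm_num) (fun _ h => h)
      simpa [e0, hl', e3'] using e5
    · refine Triple.branchFalse e0 <| Triple.branchTrue hl' <| Triple.seq <| Triple.push <|
        Triple.pop <| Triple.pop ?_
      simpa [e0, hl', e3'] using e5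
    · refine Triple.branchTrue e0 <| Triple.branchFalse hl' <| Triple.seq <| Triple.push <|
        Triple.pop <| Triple.pop ?_
      simpa [e0, hl', e3'] using e5
    · refine (Triple.branchTrue e0 <| Triple.branchTrue hl' <| Triple.pop <| Triple.pop ?_).mono
        (by norm_num) (fun _ h => h)
      simpa [e0, hl', e3'] using e5
  · rintro τ ⟨e0, e3, e5⟩
    have : τ 3 = [] := List.length_eq_zero_iff.mp e3
    exact ⟨e0, by simpa [this] using e5⟩

theorem polyTime_gen (f : KeyedFunction) : PolyTime
    (fun i : (n : ℕ) × BitVec (f.keyLen n) => [ones i.1, bits i.2]) (fun i => bits i.2) := by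
  refine polyTime_of_triple (.copy 0 1) (Polynomial.X + 1) fun i => Triple.copy ?_ ?_
  · simp [initStore]
  · simp [initStore]

/-- The program for `f` is renamed to the even stacks, so its inputs are first brought to stacks
`0`, `2`, `4`. The tag on stack `3` and the mismatch flag on stack `5` are odd and survive the
recomputation. -/
theorem polyTime_vrfy (f : KeyedFunction) (hf : PolyTime
    (fun i : (n : ℕ) × BitVec (f.keyLen n) × BitVec (f.inLen n) =>
      [ones i.1, bits i.2.1, bits i.2.2])
    (fun i => bits (f.eval i.1 i.2.1 i.2.2))) : PolyTime
    (fun i : (n : ℕ) × BitVec (f.keyLen n) × BitVec (f.inLen n) × BitVec (f.outLen n) =>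
      [ones i.1, bits i.2.1, bits i.2.2.1, bits i.2.2.2])
    (fun i => [decide (f.eval i.1 i.2.1 i.2.2.1 = i.2.2.2)]) := by
  obtain ⟨p, time, hp⟩ := hf.triple
  have hinj : Function.Injective fun r : ℕ => 2 * r := fun a b h => by
    simpa using h
  refine polyTime_of_triple
    (.seq (.copy 4 2) <| .seq (.copy 2 1) <| .seq (p.map fun r => 2 * r) <| .seq compareProg <|
      .branch 5 (.push 0 true) (.push 0 false) (.push 0 false))
    ((Polynomial.X + 1) + ((Polynomial.X + 1) + (time + ((6 * Polynomial.X + 1) + 2)))) ?_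
  rintro ⟨n, k, x, t⟩
  set m := (([ones n, bits k, bits x, bits t].map List.length).sum) with hm
  have hm' : m = n + (f.keyLen n + (f.inLen n + f.outLen n)) := by simp [hm]
  simp only [Polynomial.eval_add, Polynomial.eval_X, Polynomial.eval_one, Polynomial.eval_mul,
    Polynomial.eval_ofNat]
  refine Triple.seq <| Triple.copy (by simp [initStore]; omega) ?_
  refine Triple.seq <| Triple.copy (by simp [initStore]; omega) ?_
  refine Triple.seq ?_
  refine Triple.mono (Triple.map hinj (hp ⟨n, k, x⟩) ?_
    (R := fun τ => Triple (.seq compareProg <|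
      .branch 5 (.push 0 true) (.push 0 false) (.push 0 false)) τ ((6 * m + 1) + 2)
      fun τ => τ 0 = [decide (f.eval n k x = t)]) ?_) ?_ fun _ h => h
  · intro r
    match r with
    | 0 => simp [initStore]
    | 1 => simp [initStore]
    | 2 => simp [initStore]
    | r + 3 =>
      rw [Function.update_of_ne (by omega), Function.update_of_ne (by omega)]
      simp [initStore, Nat.mul_add]
  · intro τ τ' h0 h1 h2
    have e0 : τ' 0 = bits (f.eval n k x) := (h1 0).trans h0
    have e3 : τ' 3 = bits t := by
      rw [h2 3 (by rintro ⟨r, hr⟩; dsimp only at hr; omega)]; simp [initStore]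
    have e5 : τ' 5 = [] := by
      rw [h2 5 (by rintro ⟨r, hr⟩; dsimp only at hr; omega)]; simp [initStore]
    refine Triple.seq ((compareProg_triple _ _ (by simp) τ' e0 e3 e5).mono ?_ ?_)
    · simp; omega
    · rintro ρ ⟨r0, r5⟩
      rw [bits_injective.eq_iff] at r5
      match h : ρ 5 with
      | [] =>
        refine Triple.branchNil h <| Triple.push ?_
        simp [r0, r5.mp h]
      | false :: l =>
        refine Triple.branchFalse h <| Triple.push ?_
        have : ¬ f.eval n k x = t := fun e => by simp [r5.mpr e] at h
        simp [r0, this]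
      | true :: l =>
        refine Triple.branchTrue h <| Triple.push ?_
        have : ¬ f.eval n k x = t := fun e => by simp [r5.mpr e] at h
        simp [r0, this]
  · apply eval_le_eval
    simp; omega

theorem KeyedFunction.toMAC_isMAC {f : KeyedFunction} (hf : f.IsEfficient) : f.toMAC.IsMAC where
  coinLen_polyTime := hf.1
  gen_polyTime := polyTime_gen f
  mac_polyTime := hf.2.2.2.2
  vrfy_polyTime := polyTime_vrfy f hf.2.2.2.2
  le_keyLen := hf.2.2.2.1
  correct := fun n k m t => by simp [toMAC]

/-! ### Programs that print parametrised families of numbers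

The parameters and the loop counters `v 0, v 1, …` are kept in unary on the stacks `1, 2, …`; the
text is printed on stack `0`. -/

/-- Polynomial expressions in the variables `v i`. -/
inductive Expr : Type
  | var (i : ℕ)
  | const (c : ℕ)
  | add (a b : Expr)
  | mul (a b : Expr)

namespace Expr

/-- The value of an expression. -/
def eval (v : ℕ → ℕ) : Expr → ℕ
  | var i => v i
  | const c => c
  | add a b => a.eval v + b.eval v
  | mul a b => a.eval v * b.eval v

/-- Only variables with index less than `k` occur. -/
def Scoped (k : ℕ) : Expr → Prop
  | var i => i < k
  | const _ => True
  | add a b => a.Scoped k ∧ b.Scoped k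
  | mul a b => a.Scoped k ∧ b.Scoped k

/-- The program that writes `c` on stack `d`, in unary. -/
def constProg (d : ℕ) : ℕ → Prog
  -- There is no empty program; a push followed by a pop replaces it.
  | 0 => .seq (.push d true) (.pop d)
  | c + 1 => .seq (constProg d c) (.push d true)

/-- Adds the counter on stack `s` to the one on stack `d`. -/
def transferProg (d s : ℕ) : Prog := .loop s (.seq (.pop s) (.push d true))

/-- The program that writes the value of an expression on stack `d`. The stacks above `d` serve as
work space. -/
def prog (d : ℕ) : Expr → Prog
  | var i => .copy d (i + 1)
  | const c => constProg d c
  | add a b => .seq (a.prog d) (.seq (b.prog (d + 1)) (transferProg d (d + 1)))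
  | mul a b => .seq (a.prog (d + 1)) <| .seq (b.prog (d + 2)) <| .seq
      (.loop (d + 1) (.seq (.pop (d + 1)) (.seq (.copy (d + 3) (d + 2)) (transferProg d (d + 3)))))
      (.loop (d + 2) (.pop (d + 2)))

/-- `τ` is `σ` with the content of stack `d` replaced by `l`. -/
def Sets (d : ℕ) (l : List Bool) (σ τ : Store) : Prop := τ d = l ∧ ∀ s, s ≠ d → τ s = σ s

theorem constProg_triple (d : ℕ) (c : ℕ) (σ : Store) (h : σ d = []) :
    Triple (constProg d c) σ (c + 2) (Sets d (ones c) σ) := by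
  induction c with
  | zero =>
    refine (Triple.seq (T := 1) <| Triple.push <| Triple.pop ?_)
    refine ⟨by simp [h, ones], fun s hs => by simp [hs]⟩
  | succ c ih =>
    refine (Triple.seq (T := 1) <| ih.mono le_rfl ?_).mono (by omega) fun _ h => h
    rintro τ ⟨h1, h2⟩
    refine Triple.push ⟨by simp [h1, ones_succ], fun s hs => by simp [hs, h2 s hs]⟩

/-- Stack `d` may hold any text and only the height of stack `s` counts. This serves both for
printing a number in front of a text and for turning the length of a text into a counter. -/
theorem transferProg_list_triple {d s : ℕ} (hds : d ≠ s) (l : List Bool) (y : ℕ) (σ : Store)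
    (hx : σ d = l) (hy : (σ s).length = y) : Triple (transferProg d s) σ (y * 3 + 1)
      fun τ => τ d = ones y ++ l ∧ τ s = [] ∧ ∀ r, r ≠ d → r ≠ s → τ r = σ r := by
  refine (Triple.loop (T := 2) (fun m τ => m ≤ y ∧ τ d = ones (y - m) ++ l ∧ (τ s).length = m ∧
    ∀ r, r ≠ d → r ≠ s → τ r = σ r) (fun τ h => List.length_eq_zero_iff.mp h.2.2.1)
    (fun m τ h e => by simp [e] at h) ?_ y σ
    ⟨le_rfl, by simp [hx, ones], hy, fun _ _ _ => rfl⟩).mono le_rfl ?_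
  · rintro m τ ⟨hm, h1, h2, h3⟩
    refine (Triple.seq (S := 1) (T := 1) <| Triple.pop <| Triple.push ?_)
    refine ⟨by omega, ?_, ?_, ?_⟩
    · simp only [Function.update_self, Function.update_of_ne hds, h1, ← List.cons_append,
        ← ones_succ]
      congr 2; omega
    · simp [Function.update_of_ne hds.symm, h2]
    · intro r h4 h5
      simp [h4, h5, h3 r h4 h5]
  · rintro τ ⟨_, h1, h2, h3⟩
    exact ⟨by simpa using h1, List.length_eq_zero_iff.mp h2, h3⟩

theorem transferProg_triple {d s : ℕ} (hds : d ≠ s) (x y : ℕ) (σ : Store) (hx : σ d = ones x)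
    (hy : σ s = ones y) : Triple (transferProg d s) σ (y * 3 + 1)
      fun τ => τ d = ones (x + y) ∧ τ s = [] ∧ ∀ r, r ≠ d → r ≠ s → τ r = σ r :=
  (transferProg_list_triple hds _ y σ hx (by simp [hy])).mono le_rfl fun τ h =>
    ⟨by rw [h.1]; simp [ones, Nat.add_comm x], h.2⟩

/-- Values of expressions are stack heights and numbers of loop rounds, so they enter the running
times. -/
theorem eval_le (e : Expr) (k : ℕ) (he : e.Scoped k) : ∃ P : Polynomial ℕ, ∀ (v : ℕ → ℕ) (M : ℕ),
    (∀ i, i < k → v i ≤ M) → e.eval v ≤ P.eval M := by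
  induction e with
  | var i => exact ⟨.X, fun v M h => by simpa [eval] using h i he⟩
  | const c => exact ⟨.C c, fun v M h => by simp [eval]⟩
  | add a b iha ihb =>
    obtain ⟨P, hP⟩ := iha he.1
    obtain ⟨Q, hQ⟩ := ihb he.2
    exact ⟨P + Q, fun v M h => by
      rw [Polynomial.eval_add]; exact Nat.add_le_add (hP v M h) (hQ v M h)⟩
  | mul a b iha ihb =>
    obtain ⟨P, hP⟩ := iha he.1
    obtain ⟨Q, hQ⟩ := ihb he.2
    exact ⟨P * Q, fun v M h => by
      rw [Polynomial.eval_mul]; exact Nat.mul_le_mul (hP v M h) (hQ v M h)⟩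

/-- One polynomial serves all valuations bounded by `M`. All work stacks are emptied again, so that
evaluations can be composed. -/
theorem prog_triple (e : Expr) (k : ℕ) (he : e.Scoped k) : ∀ d, k ≤ d →
    ∃ P : Polynomial ℕ, ∀ (v : ℕ → ℕ) (M : ℕ) (σ : Store),
      (∀ i, i < k → v i ≤ M) → (∀ i, i < k → σ (i + 1) = ones (v i)) →
      (∀ s, d + 1 ≤ s → σ s = []) →
      Triple (e.prog (d + 1)) σ (P.eval M) (Sets (d + 1) (ones (e.eval v)) σ) := by
  induction e with
  | var i =>
    intro d hd
    refine ⟨.X + 1, fun v M σ hM hv hs => ?_⟩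
    refine Triple.copy ?_ ⟨?_, fun s hs => by simp [hs]⟩
    · rw [hv i he]; simpa using hM i he
    · simp [hv i he, eval]
  | const c =>
    intro d hd
    refine ⟨.C (c + 2), fun v M σ hM hv hs => ?_⟩
    simpa [prog, eval] using constProg_triple (d + 1) c σ (hs _ le_rfl)
  | add a b iha ihb =>
    intro d hd
    obtain ⟨P, hP⟩ := iha he.1 d hd
    obtain ⟨Q, hQ⟩ := ihb he.2 (d + 1) (by omega)
    obtain ⟨B, hB⟩ := b.eval_le k he.2
    refine ⟨P + (Q + (B * 3 + 1)), fun v M σ hM hv hs => ?_⟩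
    simp only [Polynomial.eval_add, Polynomial.eval_mul, Polynomial.eval_one,
      Polynomial.eval_ofNat]
    refine Triple.seq <| (hP v M σ hM hv hs).mono le_rfl ?_
    rintro τ ⟨h1, h2⟩
    refine Triple.seq <| (hQ v M τ hM (fun i hi => ?_) fun s hs' => ?_).mono le_rfl ?_
    · rw [h2 _ (by omega), hv i hi]
    · rw [h2 _ (by omega), hs s (by omega)]
    rintro ρ ⟨h3, h4⟩
    refine (transferProg_triple (d := d + 1) (s := d + 1 + 1) (by omega) (a.eval v) (b.eval v) ρ
      (by rw [h4 _ (by omega), h1]) h3).mono ?_ ?_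
    · have := hB v M hM; omega
    · rintro π ⟨h5, h6, h7⟩
      refine ⟨h5, fun s hs' => ?_⟩
      by_cases hs2 : s = d + 1 + 1
      · rw [hs2, h6, hs _ (by omega)]
      · rw [h7 s hs' hs2, h4 s hs2, h2 s hs']
  | mul a b iha ihb =>
    intro d hd
    obtain ⟨P, hP⟩ := iha he.1 (d + 1) (by omega)
    obtain ⟨Q, hQ⟩ := ihb he.2 (d + 2) (by omega)
    obtain ⟨A, hA⟩ := a.eval_le k he.1
    obtain ⟨B, hB⟩ := b.eval_le k he.2
    refine ⟨P + (Q + ((A * ((1 + ((B + 1) + (B * 3 + 1))) + 1) + 1) + (B * 2 + 1))),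
      fun v M σ hM hv hs => ?_⟩
    simp only [Polynomial.eval_add, Polynomial.eval_mul, Polynomial.eval_one,
      Polynomial.eval_ofNat]
    have hAM := hA v M hM
    have hBM := hB v M hM
    refine Triple.seq <| (hP v M σ hM hv fun s h => hs s (by omega)).mono le_rfl ?_
    rintro τ ⟨h1, h2⟩
    refine Triple.seq <| (hQ v M τ hM (fun i hi => ?_) fun s hs' => ?_).mono le_rfl ?_
    · rw [h2 _ (by omega), hv i hi]
    · rw [h2 _ (by omega), hs s (by omega)]
    rintro ρ ⟨h3, h4⟩
    set x := a.eval v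
    set y := b.eval v
    -- Multiplication is iterated addition: `m` rounds are still due, stack `d + 1` accumulates,
    -- stack `d + 3` keeps `y`, and each round consumes a copy of `y` on stack `d + 4`.
    refine Triple.seq <| (Triple.loop (T := 1 + ((B.eval M + 1) + (B.eval M * 3 + 1)))
      (fun m π => m ≤ x ∧ π (d + 1) = ones ((x - m) * y) ∧ π (d + 1 + 1) = ones m ∧
        π (d + 1 + 2) = ones y ∧ π (d + 1 + 3) = [] ∧
        ∀ s, s < d + 1 ∨ d + 1 + 3 < s → π s = σ s) (fun π h => h.2.2.1)
      (fun m π h => by rw [h.2.2.1]; simp [ones_succ]) ?_ x ρ ?_).mono ?_ ?_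
    · rintro m π ⟨hm, e1, e2, e3, e4, e5⟩
      refine Triple.seq <| Triple.pop <| Triple.seq <| Triple.copy ?_ ?_
      · simp [e3, hBM]
      refine (transferProg_triple (d := d + 1) (s := d + 1 + 3) (by omega) ((x - (m + 1)) * y) y _
        ?_ ?_).mono (by omega) ?_
      · simp [e1]
      · simp [e3]
      · rintro π' ⟨f1, f2, f3⟩
        refine ⟨by omega, ?_, ?_, ?_, f2, ?_⟩
        · rw [f1]; congr 1
          rw [← Nat.succ_mul]; congr 1; omega
        · rw [f3 _ (by omega) (by omega)]; simp [e2, ones_succ]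
        · rw [f3 _ (by omega) (by omega)]; simp [e3]
        · intro s hs'
          rw [f3 _ (by omega) (by omega), Function.update_of_ne (by omega),
            Function.update_of_ne (by omega), e5 s hs']
    · refine ⟨le_rfl, ?_, ?_, h3, ?_, ?_⟩
      · rw [h4 _ (by omega), h2 _ (by omega), hs _ (by omega)]; simp [ones]
      · rw [h4 _ (by omega), h1]
      · rw [h4 _ (by omega), h2 _ (by omega), hs _ (by omega)]
      · intro s hs'
        rw [h4 _ (by omega), h2 _ (by omega)]
    · gcongr
    rintro π ⟨-, e1, e2, e3, e4, e5⟩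
    refine (Triple.loop (T := 1)
      (fun m π' => π' (d + 1 + 2) = ones m ∧ ∀ s, s ≠ d + 1 + 2 → π' s = π s) (fun π h => h.1)
      (fun m π h => by rw [h.1]; simp [ones_succ]) ?_ y π ⟨e3, fun _ _ => rfl⟩).mono (by omega) ?_
    · rintro m π' ⟨g1, g2⟩
      refine Triple.pop ⟨by simp [g1, ones_succ], fun s hs' => by simp [hs', g2 s hs']⟩
    · rintro π' ⟨g1, g2⟩
      refine ⟨by rw [g2 _ (by omega), e1]; rfl, fun s hs' => ?_⟩
      by_cases c2 : s = d + 1 + 2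
      · rw [c2, g1, hs _ (by omega)]; rfl
      rw [g2 s c2]
      by_cases c1 : s = d + 1 + 1
      · rw [c1, e2, hs _ (by omega)]; rfl
      by_cases c3 : s = d + 1 + 3
      · rw [c3, e4, hs _ (by omega)]
      · exact e5 s (by omega)

end Expr

/-- Texts composed of numbers, in the self-delimiting code. `loop N g` stands for the texts `g` with
the next free variable equal to `0, 1, …, N - 1`. -/
inductive Text : Type
  | nil
  | nat (e : Expr)
  | app (g h : Text)
  | loop (N : Expr) (g : Text)

namespace Text

/-- The text, where the first `k` variables are in use. -/
def eval (k : ℕ) (v : ℕ → ℕ) : Text → List Bool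
  | nil => []
  | nat e => natCode (e.eval v)
  | app g h => g.eval k v ++ h.eval k v
  | loop N g => (List.range (N.eval v)).flatMap fun i => g.eval (k + 1) (Function.update v k i)

/-- Only variables in use occur. -/
def Scoped (k : ℕ) : Text → Prop
  | nil => True
  | nat e => e.Scoped k
  | app g h => g.Scoped k ∧ h.Scoped k
  | loop N g => N.Scoped k ∧ g.Scoped (k + 1)

/-- The program that prints the text. -/
def prog (k : ℕ) : Text → Prog
  | nil => .seq (.push 0 true) (.pop 0)
  | nat e => .seq (.push 0 false) (.seq (e.prog (k + 1)) (Expr.transferProg 0 (k + 1)))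
  | app g h => .seq (h.prog k) (g.prog k)
  | loop N g => .seq (N.prog (k + 1)) (.loop (k + 1) (.seq (.pop (k + 1)) (g.prog (k + 1))))

theorem flatMap_range_succ {α : Type} (f : ℕ → List α) (n : ℕ) :
    (List.range (n + 1)).flatMap f = (List.range n).flatMap f ++ f n := by
  simp [List.range_succ]

/-- Pushing builds a text from its end, so everything is printed back to front: `app` runs its
second part first, and loops count down. After the pop, the loop counter on stack `k + 1` is itself
the value of the new variable. -/
theorem prog_triple (g : Text) : ∀ k, g.Scoped k →
    ∃ P : Polynomial ℕ, ∀ (v : ℕ → ℕ) (M : ℕ) (σ : Store),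
      (∀ i, i < k → v i ≤ M) → (∀ i, i < k → σ (i + 1) = ones (v i)) →
      (∀ s, k + 1 ≤ s → σ s = []) →
      Triple (g.prog k) σ (P.eval M) (Expr.Sets 0 (g.eval k v ++ σ 0) σ) := by
  induction g with
  | nil =>
    intro k _
    refine ⟨2, fun v M σ hM hv hs => ?_⟩
    rw [Polynomial.eval_ofNat]
    refine Triple.seq (S := 1) (T := 1) <| Triple.push <| Triple.pop ⟨by simp [eval], fun s hs => ?_⟩
    simp [hs]
  | nat e =>
    intro k he
    obtain ⟨P, hP⟩ := e.prog_triple k he k le_rfl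
    obtain ⟨A, hA⟩ := e.eval_le k he
    refine ⟨1 + (P + (A * 3 + 1)), fun v M σ hM hv hs => ?_⟩
    simp only [Polynomial.eval_add, Polynomial.eval_mul, Polynomial.eval_one,
      Polynomial.eval_ofNat]
    refine Triple.seq <| Triple.push <| Triple.seq <| (hP v M _ hM (fun i hi => ?_)
      fun s hs' => ?_).mono le_rfl ?_
    · simp [hv i hi]
    · rw [Function.update_of_ne (by omega), hs s hs']
    rintro τ ⟨h1, h2⟩
    refine (Expr.transferProg_list_triple (d := 0) (s := k + 1) (by omega) (false :: σ 0) (e.eval v) τ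
      (by rw [h2 _ (by omega)]; simp) (by simp [h1])).mono (by have := hA v M hM; omega) ?_
    rintro ρ ⟨h3, h4, h5⟩
    refine ⟨by simp [h3, eval, natCode], fun s hs' => ?_⟩
    by_cases hsk : s = k + 1
    · rw [hsk, h4, hs _ le_rfl]
    · rw [h5 s hs' hsk, h2 s hsk, Function.update_of_ne hs']
  | app g h ihg ihh =>
    intro k hgh
    obtain ⟨P, hP⟩ := ihg k hgh.1
    obtain ⟨Q, hQ⟩ := ihh k hgh.2
    refine ⟨Q + P, fun v M σ hM hv hs => ?_⟩
    rw [Polynomial.eval_add]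
    refine Triple.seq <| (hQ v M σ hM hv hs).mono le_rfl ?_
    rintro τ ⟨h1, h2⟩
    refine (hP v M τ hM (fun i hi => ?_) fun s hs' => ?_).mono le_rfl ?_
    · rw [h2 _ (by omega), hv i hi]
    · rw [h2 _ (by omega), hs s hs']
    rintro ρ ⟨h3, h4⟩
    exact ⟨by simp [h3, h1, eval], fun s hs' => by rw [h4 s hs', h2 s hs']⟩
  | loop N g ih =>
    intro k hg
    obtain ⟨P, hP⟩ := N.prog_triple k hg.1 k le_rfl
    obtain ⟨A, hA⟩ := N.eval_le k hg.1
    obtain ⟨Q, hQ⟩ := ih (k + 1) hg.2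
    -- Inside the loop the new variable is below the value of `N`, hence `M + A.eval M` bounds all
    -- variables in use.
    refine ⟨P + (A * ((1 + Q.comp (.X + A)) + 1) + 1), fun v M σ hM hv hs => ?_⟩
    simp only [Polynomial.eval_add, Polynomial.eval_mul, Polynomial.eval_one,
      Polynomial.eval_comp, Polynomial.eval_X]
    have hAM := hA v M hM
    set n := N.eval v with hn
    refine Triple.seq <| (hP v M σ hM hv hs).mono le_rfl ?_
    rintro τ ⟨h1, h2⟩
    let f : ℕ → List Bool := fun i => g.eval (k + 1) (Function.update v k i)
    -- The iterations still due, followed by what is already printed, always make up the complete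
    -- text.
    refine (Triple.loop (T := 1 + Q.eval (M + A.eval M)) (fun m π => m ≤ n ∧
      (List.range m).flatMap f ++ π 0 = (List.range n).flatMap f ++ σ 0 ∧
      π (k + 1) = ones m ∧ ∀ s, s ≠ 0 → s ≠ k + 1 → π s = σ s) (fun π h => h.2.2.1)
      (fun m π h => by rw [h.2.2.1]; simp [ones_succ]) ?_ n τ ?_).mono (by gcongr) ?_
    · rintro m π ⟨hm, e1, e2, e3⟩
      refine Triple.seq <| Triple.pop <| (hQ (Function.update v k m) (M + A.eval M) _
        (fun i hi => ?_) (fun i hi => ?_) (fun s hs' => ?_)).mono le_rfl ?_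
      · by_cases hik : i = k
        · subst hik; simp; omega
        · rw [Function.update_of_ne hik]; have := hM i (by omega); omega
      · by_cases hik : i = k
        · subst hik; simp [e2, ones_succ]
        · rw [Function.update_of_ne (by omega), Function.update_of_ne hik, e3 _ (by omega)
            (by omega), hv i (by omega)]
      · rw [Function.update_of_ne (by omega), e3 _ (by omega) (by omega), hs s (by omega)]
      · rintro ρ ⟨f1, f2⟩
        refine ⟨by omega, ?_, ?_, fun s h0 h1 => ?_⟩
        · rw [f1, ← e1, flatMap_range_succ]; simp [f]
        · rw [f2 _ (by omega)]; simp [e2, ones_succ]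
        · rw [f2 _ h0, Function.update_of_ne h1, e3 s h0 h1]
    · exact ⟨le_rfl, by rw [h2 _ (by omega)], h1, fun s _ hs' => h2 s hs'⟩
    · rintro π ⟨-, e1, e2, e3⟩
      refine ⟨by simpa [eval] using e1, fun s hs' => ?_⟩
      by_cases hsk : s = k + 1
      · rw [hsk, e2, hs _ le_rfl]; rfl
      · exact e3 s hs' hsk

end Text

/-! ### Extending a printed description -/

/-- Moves the content of stack `s` to stack `d`, which reverses it. -/
def moveProg (d s : ℕ) : Prog :=
  .loop s (.seq (.branch s (.pop s) (.push d false) (.push d true)) (.pop s))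

theorem moveProg_triple {d s : ℕ} (hds : d ≠ s) (l : List Bool) (σ : Store) (h : σ s = l) :
    Triple (moveProg d s) σ (l.length * 4 + 1)
      fun τ => τ d = l.reverse ++ σ d ∧ τ s = [] ∧ ∀ r, r ≠ d → r ≠ s → τ r = σ r := by
  refine (Triple.loop_list (T := 3) (fun m τ => τ s = m ∧ m.reverse ++ τ d = l.reverse ++ σ d ∧
    ∀ r, r ≠ d → r ≠ s → τ r = σ r) (fun _ _ h => h.1) ?_ l σ ⟨h, rfl, fun _ _ _ => rfl⟩).mono
    le_rfl ?_
  · rintro b m τ ⟨h1, h2, h3⟩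
    refine Triple.seq (S := 2) (T := 1) ?_
    cases b
    · refine Triple.branchFalse h1 <| Triple.push <| Triple.pop ⟨?_, ?_, fun r h4 h5 => ?_⟩
      · simp [Function.update_of_ne hds.symm, h1]
      · simpa [Function.update_of_ne hds] using h2
      · simp [h4, h5, h3 r h4 h5]
    · refine Triple.branchTrue h1 <| Triple.push <| Triple.pop ⟨?_, ?_, fun r h4 h5 => ?_⟩
      · simp [Function.update_of_ne hds.symm, h1]
      · simpa [Function.update_of_ne hds] using h2
      · simp [h4, h5, h3 r h4 h5]
  · rintro τ ⟨h1, h2, h3⟩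
    exact ⟨by simpa using h2, h1, h3⟩

/-- Splits a number off the text on stack `0`, and writes it on stack `8` in unary. -/
def splitProg : Prog :=
  .seq (.push 4 true) (.loop 4
    (.branch 0 (.pop 4) (.seq (.pop 0) (.pop 4)) (.seq (.pop 0) (.push 8 true))))

theorem splitProg_triple (q : ℕ) (G : List Bool) (σ : Store) (h0 : σ 0 = natCode q ++ G)
    (h4 : σ 4 = []) (h8 : σ 8 = []) : Triple splitProg σ (1 + ((q + 1) * 4 + 1))
      fun τ => τ 0 = G ∧ τ 8 = ones q ∧ ∀ r, r ≠ 0 → r ≠ 8 → τ r = σ r := by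
  refine Triple.seq <| Triple.push ?_
  -- Stack `4` signals that the terminating `0` has not been read. Index `m + 1` means that `m` ones
  -- and this terminator remain, so there are `q + 1` rounds.
  refine (Triple.loop (T := 3) (fun m τ => (∀ r, r ≠ 0 → r ≠ 8 → r ≠ 4 → τ r = σ r) ∧
    match m with
    | 0 => τ 0 = G ∧ τ 8 = ones q ∧ τ 4 = []
    | m + 1 => m ≤ q ∧ τ 0 = natCode m ++ G ∧ τ 8 = ones (q - m) ∧ τ 4 = [true])
    (fun τ h => h.2.2.2) (fun m τ h => by simp [h.2.2.2.2]) ?_ (q + 1) _ ?_).mono le_rfl ?_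
  · rintro m τ ⟨h1, hm, h2, h3, h5⟩
    cases m with
    | zero =>
      refine Triple.branchFalse (l := G) (by simpa [natCode, ones] using h2) <|
        Triple.seq (S := 1) (T := 1) <| Triple.pop <| Triple.pop ⟨fun r e1 e2 e3 => ?_, ?_, ?_, ?_⟩
      · simp [e1, e3, h1 r e1 e2 e3]
      · simp [h2, natCode, ones]
      · simpa using h3
      · simp [h5]
    | succ m =>
      refine Triple.branchTrue (l := natCode m ++ G) (by simpa [natCode, ones_succ] using h2) <|
        Triple.seq (S := 1) (T := 1) <| Triple.pop <| Triple.push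
          ⟨fun r e1 e2 e3 => ?_, by omega, ?_, ?_, ?_⟩
      · simp [e1, e2, h1 r e1 e2 e3]
      · simp [h2, natCode, ones_succ]
      · simp only [ne_eq, OfNat.ofNat_ne_zero, not_false_eq_true, Function.update_of_ne, h3,
          ← ones_succ, Function.update_self]
        congr 1; omega
      · simpa using h5
  · exact ⟨fun r _ _ e => by simp [e], le_rfl, by simpa using h0, by simp [h8, ones], by simp [h4]⟩
  · rintro τ ⟨h1, h2, h3, h5⟩
    refine ⟨h2, h3, fun r e1 e2 => ?_⟩
    by_cases e3 : r = 4
    · rw [e3, h5, h4]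
    · exact h1 r e1 e2 e3

/-- Where the program of a text finds its stacks. -/
def textStack (r : ℕ) : ℕ := if r = 0 then 0 else 5 * r + 3

theorem textStack_injective : Function.Injective textStack := by
  intro r s h
  unfold textStack at h
  split_ifs at h <;> omega

/-- The parameters `q, a, b, L` as variables. -/
def params (q a b L : ℕ) : ℕ → ℕ
  | 0 => q
  | 1 => a
  | 2 => b
  | 3 => L
  | _ => 0

/-- `textStack` puts the four parameters on stacks `8, 13, 18, 23` and the work space on later
stacks congruent to `3` modulo `5`. The other residues, except for the output stack `0`, remain
untouched. -/
theorem Text.map_prog_triple (g : Text) (hg : g.Scoped 4) : ∃ P : Polynomial ℕ,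
    ∀ (q a b L M : ℕ) (σ : Store), q ≤ M → a ≤ M → b ≤ M → L ≤ M →
      σ 8 = ones q → σ 13 = ones a → σ 18 = ones b → σ 23 = ones L →
      (∀ r, 5 ≤ r → σ (5 * r + 3) = []) →
      Triple ((g.prog 4).map textStack) σ (P.eval M)
        fun τ => τ 0 = g.eval 4 (params q a b L) ++ σ 0 ∧ ∀ r, r ≠ 0 → τ r = σ r := by
  obtain ⟨P, hP⟩ := g.prog_triple 4 hg
  refine ⟨P, fun q a b L M σ hq ha hb hL e1 e2 e3 e4 e5 => ?_⟩
  refine (hP (params q a b L) M (σ ∘ textStack) (fun i hi => ?_) (fun i hi => ?_)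
    fun s hs => ?_).map textStack_injective (fun _ => rfl) ?_
  · interval_cases i <;> assumption
  · interval_cases i <;> assumption
  · simp only [Function.comp, textStack]
    rw [if_neg (by omega)]; exact e5 s hs
  · rintro τ τ' ⟨h1, h2⟩ h3 h4
    refine ⟨(h3 0).trans h1, fun r hr => ?_⟩
    by_cases hrr : r ∈ Set.range textStack
    · obtain ⟨s, rfl⟩ := hrr
      exact (h3 s).trans (h2 s (by rintro rfl; exact hr rfl))
    · exact h4 r hrr

/-- If the texts `natCode (q n) ++ G n` are printed in polynomial time, then `G n` can in polynomial
time be provided with a new number in front and a new text at the end, which depend on `q n`, two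
other numbers, and the length of the original text. -/
theorem polyTime_extend {q a b : ℕ → ℕ} {G : ℕ → List Bool}
    (hG : PolyTime (fun n : ℕ => [ones n]) fun n => natCode (q n) ++ G n)
    (ha : PolyTimeLength a) (hb : PolyTimeLength b) (e : Expr) (he : e.Scoped 4) (g : Text)
    (hg : g.Scoped 4) : PolyTime (fun n : ℕ => [ones n]) fun n =>
      natCode (e.eval (params (q n) (a n) (b n) (natCode (q n) ++ G n).length)) ++
        (G n ++ g.eval 4 (params (q n) (a n) (b n) (natCode (q n) ++ G n).length)) := by
  obtain ⟨C, hC⟩ := hG.length_le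
  obtain ⟨A, hA⟩ := PolyTime.length_le ha
  obtain ⟨B, hB⟩ := PolyTime.length_le hb
  obtain ⟨p0, T0, h0⟩ := hG.triple
  obtain ⟨p1, T1, h1⟩ := PolyTime.triple ha
  obtain ⟨p2, T2, h2⟩ := PolyTime.triple hb
  obtain ⟨T3, h3⟩ := g.map_prog_triple hg
  obtain ⟨T4, h4⟩ := (Text.nat e).map_prog_triple he
  have i0 : Function.Injective fun r : ℕ => 5 * r := fun x y h => by simpa using h
  have i1 : Function.Injective fun r : ℕ => 5 * r + 1 := fun x y h => by simpa using h
  have i2 : Function.Injective fun r : ℕ => 5 * r + 2 := fun x y h => by simpa using h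
  -- Stacks are shared out by residues modulo `5`: the three given programs use the classes `0`,
  -- `1`, `2`, the printers use class `3` and stack `0`, and stacks `4` and `9` are scratch. Stacks
  -- `1` and `2` receive copies of `1ⁿ` because they are the input stacks of the second and third
  -- programs.
  refine polyTime_of_triple
    (.seq (.copy 1 0) <| .seq (.copy 2 0) <| .seq (p0.map fun r => 5 * r) <|
      .seq (p1.map fun r => 5 * r + 1) <| .seq (p2.map fun r => 5 * r + 2) <|
      .seq (.copy 4 0) <| .seq (Expr.transferProg 23 4) <| .seq splitProg <|
      .seq (.copy 13 1) <| .seq (.copy 18 2) <| .seq (moveProg 9 0) <|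
      .seq ((g.prog 4).map textStack) <| .seq (moveProg 0 9) (((Text.nat e).prog 4).map textStack))
    ((.X + 1) + ((.X + 1) + (T0 + (T1 + (T2 + ((C + 1) + ((C * 3 + 1) + ((1 + ((C + 1) * 4 + 1)) +
      ((A + 1) + ((B + 1) + ((C * 4 + 1) + (T3.comp (A + B + C) + ((C * 4 + 1) +
        T4.comp (A + B + C)))))))))))))) fun n => ?_
  have hC' := hC n
  have hA' := hA n
  have hB' := hB n
  have h0' := h0 n
  have h1' := h1 n
  have h2' := h2 n
  simp only [List.map_cons, List.map_nil, List.sum_cons, List.sum_nil, length_ones,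
    Nat.add_zero] at hC' hA' hB' h0' h1' h2' ⊢
  have hlen : (natCode (q n) ++ G n).length = q n + 1 + (G n).length := by
    simp [natCode]; omega
  set L := (natCode (q n) ++ G n).length with hL
  simp only [Polynomial.eval_add, Polynomial.eval_mul, Polynomial.eval_one, Polynomial.eval_X,
      Polynomial.eval_ofNat, Polynomial.eval_comp]
  refine Triple.seq <| Triple.copy (by simp [initStore]) ?_
  refine Triple.seq <| Triple.copy (by simp [initStore]) ?_
  have hσ : ∀ r, Function.update (Function.update (initStore [ones n]) 1 (initStore [ones n] 0)) 2
      (Function.update (initStore [ones n]) 1 (initStore [ones n] 0) 0) r =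
        if r < 3 then ones n else [] := by
    intro r
    match r with
    | 0 => simp [initStore]
    | 1 => simp [initStore]
    | 2 => simp [initStore]
    | r + 3 => simp [initStore]
  generalize Function.update (Function.update (initStore [ones n]) 1 (initStore [ones n] 0)) 2
      (Function.update (initStore [ones n]) 1 (initStore [ones n] 0) 0) = σ at hσ
  refine Triple.seq <| h0'.map i0 (fun r => ?_) ?_
  · rw [hσ]; cases r <;> simp [initStore]
    omega
  intro τ₀ σ₀ e0 e1 e2
  have k0 : σ₀ 0 = natCode (q n) ++ G n := (e1 0).trans e0
  have k0' : ∀ r, r % 5 ≠ 0 → σ₀ r = σ r := fun r hr => e2 r (by rintro ⟨s, hs⟩; dsimp at hs; omega)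
  clear e0 e1 e2
  refine Triple.seq <| h1'.map i1 (fun r => ?_) ?_
  · rw [k0' _ (by omega), hσ]; cases r <;> simp [initStore]
    omega
  intro τ₁ σ₁ e0 e1 e2
  have k1 : σ₁ 1 = ones (a n) := (e1 0).trans e0
  have k1' : ∀ r, r % 5 ≠ 1 → σ₁ r = σ₀ r :=
    fun r hr => e2 r (by rintro ⟨s, hs⟩; dsimp at hs; omega)
  clear e0 e1 e2
  refine Triple.seq <| h2'.map i2 (fun r => ?_) ?_
  · rw [k1' _ (by omega), k0' _ (by omega), hσ]; cases r <;> simp [initStore]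
    omega
  intro τ₂ σ₂ e0 e1 e2
  have k2 : σ₂ 2 = ones (b n) := (e1 0).trans e0
  have k2' : ∀ r, r % 5 ≠ 2 → σ₂ r = σ₁ r :=
    fun r hr => e2 r (by rintro ⟨s, hs⟩; dsimp at hs; omega)
  clear e0 e1 e2
  have k3 : ∀ r, r % 5 = 3 ∨ r % 5 = 4 → σ₂ r = if r < 3 then ones n else [] := fun r hr => by
    rw [k2' r (by omega), k1' r (by omega), k0' r (by omega), hσ]
  have k4 : ∀ r, 2 < r → r % 5 = 3 ∨ r % 5 = 4 → σ₂ r = [] := fun r hr hr' => by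
    rw [k3 r hr', if_neg (by omega)]
  have k0 : σ₂ 0 = natCode (q n) ++ G n := by rw [k2' 0 (by omega), k1' 0 (by omega), k0]
  have k1 : σ₂ 1 = ones (a n) := by rw [k2' 1 (by omega), k1]
  clear k0' k1' k2' k3 hσ
  -- A scratch copy of the whole description is consumed to obtain `L` in unary, before the leading
  -- number is split off.
  refine Triple.seq <| Triple.copy (by rw [k0]; omega) ?_
  refine Triple.seq <| (Expr.transferProg_list_triple (d := 23) (s := 4) (by omega) [] L _ ?_
    ?_).mono (by omega) ?_
  · simp [k4]
  · rw [Function.update_self, k0]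
  rintro σ₃ ⟨m1, m2, m3⟩
  have m3' : ∀ r, r ≠ 23 → r ≠ 4 → σ₃ r = σ₂ r := fun r h h' => by
    rw [m3 r h h', Function.update_of_ne h']
  refine Triple.seq <| (splitProg_triple (q n) (G n) σ₃ (by rw [m3' _ (by omega) (by omega), k0]) m2
    (by rw [m3' _ (by omega) (by omega), k4 _ (by omega) (by omega)])).mono (by omega) ?_
  rintro σ₄ ⟨n1, n2, n3⟩
  have n3' : ∀ r, r ≠ 0 → r ≠ 8 → r ≠ 23 → r ≠ 4 → σ₄ r = σ₂ r := fun r h h' h'' h3 => by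
    rw [n3 r h h', m3' r h'' h3]
  refine Triple.seq <| Triple.copy ?_ ?_
  · rw [n3' _ (by omega) (by omega) (by omega) (by omega), k1, length_ones]; omega
  refine Triple.seq <| Triple.copy ?_ ?_
  · rw [Function.update_of_ne (by omega), n3' _ (by omega) (by omega) (by omega) (by omega), k2,
      length_ones]
    omega
  -- The old gates are parked, reversed, on stack `9`, so that the new text is printed on an empty
  -- stack. Moving them back restores their order and puts them in front.
  refine Triple.seq <| (moveProg_triple (d := 9) (s := 0) (by omega) (G n) _ ?_).mono (by omega) ?_
  · simp [n1]
  rintro σ₅ ⟨u1, u2, u3⟩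
  have v9 : σ₅ 9 = (G n).reverse := by
    rw [u1]; simp [n3', k4]
  have v8 : σ₅ 8 = ones (q n) := by rw [u3 _ (by omega) (by omega)]; simp [n2]
  have v13 : σ₅ 13 = ones (a n) := by rw [u3 _ (by omega) (by omega)]; simp [n3', k1]
  have v18 : σ₅ 18 = ones (b n) := by rw [u3 _ (by omega) (by omega)]; simp [n3', k2]
  have v23 : σ₅ 23 = ones L := by
    rw [u3 _ (by omega) (by omega)]; simp [n3 23, m1]
  have vt : ∀ r, 5 ≤ r → σ₅ (5 * r + 3) = [] := fun r hr => by
    rw [u3 _ (by omega) (by omega), Function.update_of_ne (by omega),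
      Function.update_of_ne (by omega), n3' _ (by omega) (by omega) (by omega) (by omega),
      k4 _ (by omega) (by omega)]
  refine Triple.seq <| (h3 (q n) (a n) (b n) L (A.eval n + B.eval n + C.eval n) σ₅ (by omega)
    (by omega) (by omega) (by omega) v8 v13 v18 v23 vt).mono le_rfl ?_
  rintro σ₆ ⟨w1, w2⟩
  refine Triple.seq <| (moveProg_triple (d := 0) (s := 9) (by omega) (G n).reverse _
    (by rw [w2 _ (by omega), v9])).mono (by simp; omega) ?_
  rintro σ₇ ⟨x1, x2, x3⟩
  have x3' : ∀ r, r ≠ 0 → r ≠ 9 → σ₇ r = σ₅ r := fun r h h' => by rw [x3 r h h', w2 r h]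
  refine (h4 (q n) (a n) (b n) L (A.eval n + B.eval n + C.eval n) σ₇ (by omega)
    (by omega) (by omega) (by omega) ?_ ?_ ?_ ?_ fun r hr => ?_).mono le_rfl ?_
  · rw [x3' _ (by omega) (by omega), v8]
  · rw [x3' _ (by omega) (by omega), v13]
  · rw [x3' _ (by omega) (by omega), v18]
  · rw [x3' _ (by omega) (by omega), v23]
  · rw [x3' _ (by omega) (by omega), vt r hr]
  rintro σ₈ ⟨y1, -⟩
  rw [y1, x1, w1, u2]
  simp [Text.eval]

/-! ### Registers -/

theorem getLsb_readReg {w : ℕ} (S : Finset ℕ) (r : Fin w → ℕ) (i : Fin w) :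
    (readReg S r).getLsb i = decide (r i ∈ S) := BitVec.getLsb_ofFnLE _ i

theorem getElem_readReg {w : ℕ} (S : Finset ℕ) (r : Fin w → ℕ) (i : Fin w) :
    (readReg S r)[(i : ℕ)] = decide (r i ∈ S) := getLsb_readReg S r i

theorem bitVec_ext {w : ℕ} {u v : BitVec w} (h : ∀ i, u.getLsb i = v.getLsb i) : u = v :=
  BitVec.eq_of_getLsbD_eq fun i hi => h ⟨i, hi⟩

theorem readReg_congr {w : ℕ} {S T : Finset ℕ} {r s : Fin w → ℕ}
    (h : ∀ i, r i ∈ S ↔ s i ∈ T) : readReg S r = readReg T s :=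
  bitVec_ext fun i => by rw [getLsb_readReg, getLsb_readReg, decide_eq_decide.mpr (h i)]

theorem readReg_eq_iff {w : ℕ} {S T : Finset ℕ} {r s : Fin w → ℕ} :
    readReg S r = readReg T s ↔ ∀ i, r i ∈ S ↔ s i ∈ T := by
  refine ⟨fun h i => ?_, readReg_congr⟩
  have := congrArg (fun v => v.getLsb i) h
  simpa [getElem_readReg] using this

theorem apply_mem_writeReg {w : ℕ} (S : Finset ℕ) (r : Fin w ↪ ℕ) (v : BitVec w) (i : Fin w) :
    r i ∈ writeReg S r v ↔ v.getLsb i = true := by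
  simp [writeReg]

theorem mem_writeReg_of_notMem {w : ℕ} (S : Finset ℕ) (r : Fin w ↪ ℕ) (v : BitVec w) {k : ℕ}
    (hk : ∀ i, r i ≠ k) : k ∈ writeReg S r v ↔ k ∈ S := by
  simp [writeReg, hk]

@[simp] theorem readReg_writeReg {w : ℕ} (S : Finset ℕ) (r : Fin w ↪ ℕ) (v : BitVec w) :
    readReg (writeReg S r v) r = v :=
  bitVec_ext fun i => by simp [getElem_readReg, apply_mem_writeReg]

theorem readReg_writeReg_of_disjoint {w u : ℕ} (S : Finset ℕ) (r : Fin w ↪ ℕ) (v : BitVec w)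
    (x : Fin u → ℕ) (h : ∀ i j, x i ≠ r j) : readReg (writeReg S r v) x = readReg S x :=
  readReg_congr fun i => mem_writeReg_of_notMem S r v fun j => (h i j).symm

@[simp] theorem writeReg_writeReg {w : ℕ} (S : Finset ℕ) (r : Fin w ↪ ℕ) (u v : BitVec w) :
    writeReg (writeReg S r u) r v = writeReg S r v := by
  ext k
  by_cases hk : ∃ i, r i = k
  · obtain ⟨i, rfl⟩ := hk
    simp [apply_mem_writeReg]
  · push Not at hk
    simp [mem_writeReg_of_notMem _ r _ hk]

@[simp] theorem writeReg_readReg {w : ℕ} (S : Finset ℕ) (r : Fin w ↪ ℕ) :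
    writeReg S r (readReg S r) = S := by
  ext k
  by_cases hk : ∃ i, r i = k
  · obtain ⟨i, rfl⟩ := hk
    simp [apply_mem_writeReg, getElem_readReg]
  · push Not at hk
    simp [mem_writeReg_of_notMem _ r _ hk]

theorem mem_flipWire {S : Finset ℕ} {w k : ℕ} :
    k ∈ flipWire S w ↔ if k = w then k ∉ S else k ∈ S := by
  unfold flipWire
  split_ifs with h <;> simp [Finset.mem_symmDiff, h]

@[simp] theorem flipWire_flipWire (S : Finset ℕ) (w : ℕ) : flipWire (flipWire S w) w = S := by
  simp [flipWire]

/-- The inverse of the group operation of the answer register. -/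
def QueryConvention.uncombine {b : ℕ} : QueryConvention → BitVec b → BitVec b → BitVec b
  | .xor, y, z => y ^^^ z
  | .addMod, y, z => y - z

@[simp] theorem combine_uncombine {b : ℕ} (conv : QueryConvention) (y z : BitVec b) :
    conv.combine (conv.uncombine y z) z = y := by
  cases conv
  · simp [QueryConvention.combine, QueryConvention.uncombine]
  · simp [QueryConvention.combine, QueryConvention.uncombine]

@[simp] theorem uncombine_combine {b : ℕ} (conv : QueryConvention) (y z : BitVec b) :
    conv.uncombine (conv.combine y z) z = y := by
  cases conv
  · simp [QueryConvention.combine, QueryConvention.uncombine]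
  · simp [QueryConvention.combine, QueryConvention.uncombine]

theorem combine_zero {b : ℕ} (conv : QueryConvention) (z : BitVec b) :
    conv.combine 0 z = z := by
  cases conv <;> simp [QueryConvention.combine]

/-! ### The action of the gates -/

section Gates

variable {a b : ℕ} (conv : QueryConvention) (f : BitVec a → BitVec b)

/-- Gates that permute the basis states. -/
def Gate.IsClassical : Gate a b → Prop
  | .H _ => False
  | .T _ => False
  | _ => True

/-- The action of a classical gate on the basis states. -/
def Gate.perm : Gate a b → Finset ℕ → Finset ℕ
  | .X w, S => flipWire S w
  | .H _, S => S
  | .T _, S => S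
  | .CNOT c t _, S => if c ∈ S then flipWire S t else S
  | .CCNOT c d t _ _ _, S => if c ∈ S ∧ d ∈ S then flipWire S t else S
  | .query x y _, S => writeReg S y (conv.combine (readReg S y) (f (readReg S x)))

/-- The inverse of `Gate.perm`. -/
def Gate.permInv : Gate a b → Finset ℕ → Finset ℕ
  | .query x y _, S => writeReg S y (conv.uncombine (readReg S y) (f (readReg S x)))
  | g, S => g.perm conv f S

/-- Query and answer registers are disjoint, so a query leaves its argument intact and is undone by
subtracting the same value. The controlled gates keep their controls and are involutions. -/
theorem Gate.permInv_perm (g : Gate a b) (S : Finset ℕ) :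
    g.permInv conv f (g.perm conv f S) = S := by
  cases g with
  | X w => simp [perm, permInv]
  | H w => rfl
  | T w => rfl
  | CNOT c t h =>
    by_cases hc : c ∈ S <;> simp [perm, permInv, mem_flipWire, hc, h]
  | CCNOT c d t hcd hct hdt =>
    by_cases hc : c ∈ S ∧ d ∈ S
    · simp [perm, permInv, mem_flipWire, hc, hct, hdt]
    · simp [perm, permInv, hc]
  | query x y h => simp [perm, permInv, readReg_writeReg_of_disjoint _ y _ x h]

theorem Gate.perm_permInv (g : Gate a b) (S : Finset ℕ) :
    g.perm conv f (g.permInv conv f S) = S := by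
  cases g with
  | query x y h => simp [perm, permInv, readReg_writeReg_of_disjoint _ y _ x h]
  | X w => exact Gate.permInv_perm conv f (.X w) S
  | H w => rfl
  | T w => rfl
  | CNOT c t h => exact Gate.permInv_perm conv f (.CNOT c t h) S
  | CCNOT c d t h₁ h₂ h₃ => exact Gate.permInv_perm conv f (.CCNOT c d t h₁ h₂ h₃) S

theorem Gate.perm_injective (g : Gate a b) : Function.Injective (g.perm conv f) :=
  Function.LeftInverse.injective (g.permInv_perm conv f)

theorem Gate.onBasis_of_isClassical {g : Gate a b} (hg : g.IsClassical) (S : Finset ℕ) :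
    g.onBasis conv f S = Finsupp.single (g.perm conv f S) 1 := by
  cases g <;> first | rfl | exact hg.elim

theorem Gate.apply_of_isClassical {g : Gate a b} (hg : g.IsClassical) (ψ : State) :
    g.apply conv f ψ = ψ.mapDomain (g.perm conv f) := by
  unfold Gate.apply Finsupp.mapDomain
  refine Finsupp.sum_congr fun S _ => ?_
  rw [Gate.onBasis_of_isClassical conv f hg, Finsupp.smul_single, smul_eq_mul, mul_one]

/-- In this pullback form a query affects an amplitude only through the basis state at which `ψ` is
read. -/
theorem Gate.apply_of_isClassical_apply {g : Gate a b} (hg : g.IsClassical) (ψ : State)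
    (S : Finset ℕ) : g.apply conv f ψ S = ψ (g.permInv conv f S) := by
  rw [Gate.apply_of_isClassical conv f hg]
  conv_lhs => rw [← g.perm_permInv conv f S]
  exact Finsupp.mapDomain_apply (g.perm_injective conv f) _ _

theorem Gate.apply_add (g : Gate a b) (ψ φ : State) :
    g.apply conv f (ψ + φ) = g.apply conv f ψ + g.apply conv f φ :=
  Finsupp.sum_add_index' (fun _ => zero_smul _ _) fun _ _ _ => add_smul _ _ _

theorem Gate.apply_single (g : Gate a b) (S : Finset ℕ) (α : ℂ) :
    g.apply conv f (Finsupp.single S α) = α • g.onBasis conv f S :=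
  Finsupp.sum_single_index (zero_smul _ _)

theorem Gate.apply_T_apply (w : ℕ) (ψ : State) (S : Finset ℕ) :
    (Gate.T w : Gate a b).apply conv f ψ S =
      (if w ∈ S then Complex.exp (Complex.I * Real.pi / 4) else 1) * ψ S := by
  induction ψ using Finsupp.induction_linear with
  | zero => simp [Gate.apply]
  | add ψ φ h₁ h₂ => rw [Gate.apply_add, Finsupp.add_apply, h₁, h₂, Finsupp.add_apply, mul_add]
  | single R α =>
    rw [Gate.apply_single]
    by_cases h : R = S
    · subst h; simp [Gate.onBasis, mul_comm]
    · simp [Gate.onBasis, h]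

theorem Gate.apply_H_apply (w : ℕ) (ψ : State) (S : Finset ℕ) :
    (Gate.H w : Gate a b).apply conv f ψ S = ((1 / Real.sqrt 2 : ℝ) : ℂ) *
      (ψ (S.erase w) + (if w ∈ S then -1 else 1) * ψ (insert w S)) := by
  induction ψ using Finsupp.induction_linear with
  | zero => simp [Gate.apply]
  | add ψ φ h₁ h₂ =>
    rw [Gate.apply_add, Finsupp.add_apply, h₁, h₂, Finsupp.add_apply, Finsupp.add_apply]; ring
  | single R α =>
    rw [Gate.apply_single]
    simp only [Gate.onBasis, Finsupp.smul_apply, Finsupp.add_apply, smul_eq_mul,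
      Finsupp.single_apply]
    by_cases hR : w ∈ R <;> by_cases hS : w ∈ S
    · have e1 : R ≠ S.erase w := fun e => by simp [e] at hR
      have e2 : R.erase w ≠ S := fun e => by simp [← e] at hS
      simp [hR, hS, e1, e2]
      ring_nf
    · have e1 : R ≠ S.erase w := fun e => by simp [e] at hR
      have e2 : insert w R ≠ S := fun e => by simp [← e] at hS
      have e3 : R.erase w = S ↔ R = insert w S := by
        constructor
        · rintro rfl; simp [hR]
        · rintro rfl; simp [hS]
      simp only [hR, hS, e1, e2, e3, if_true, if_false, zero_add, add_zero]
      split_ifs <;> ring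
    · have e1 : insert w S ≠ R := fun e => by simp [← e] at hR
      have e2 : R.erase w ≠ S := fun e => by simp [← e] at hS
      have e3 : insert w R = S ↔ R = S.erase w := by
        constructor
        · rintro rfl; simp [hR]
        · rintro rfl; simp [hS]
      simp only [hR, hS, e1.symm, e2, e3, if_true, if_false, zero_add]
      split_ifs <;> ring
    · have e1 : insert w S ≠ R := fun e => by simp [← e] at hR
      have e2 : insert w R ≠ S := fun e => by simp [← e] at hS
      simp only [hR, hS, e1.symm, e2, if_false, add_zero,
        Finset.erase_eq_of_notMem, not_false_eq_true]
      split_ifs <;> ring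

/-! ### Wires in use -/

/-- The gate acts on wires below `W` only. -/
def Gate.Below (W : ℕ) : Gate a b → Prop
  | .X w => w < W
  | .H w => w < W
  | .T w => w < W
  | .CNOT c t _ => c < W ∧ t < W
  | .CCNOT c d t _ _ _ => c < W ∧ d < W ∧ t < W
  | .query x y _ => (∀ i, x i < W) ∧ ∀ j, y j < W

/-- Only wires below `W` hold `1`. -/
def SetBelow (W : ℕ) (S : Finset ℕ) : Prop := ∀ w ∈ S, w < W

theorem setBelow_flipWire {W w : ℕ} {S : Finset ℕ} (hS : SetBelow W S) (hw : w < W) :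
    SetBelow W (flipWire S w) := by
  intro k hk
  by_cases h : k = w
  · omega
  · exact hS k (by simpa [mem_flipWire, h] using hk)

theorem setBelow_writeReg {W w : ℕ} {S : Finset ℕ} (hS : SetBelow W S) {r : Fin w ↪ ℕ}
    (hr : ∀ i, r i < W) (v : BitVec w) : SetBelow W (writeReg S r v) := by
  intro k hk
  by_cases h : ∃ i, r i = k
  · obtain ⟨i, rfl⟩ := h; exact hr i
  · push Not at h
    exact hS k ((mem_writeReg_of_notMem S r v h).mp hk)

variable {conv f}

theorem Gate.setBelow_perm {W : ℕ} {g : Gate a b} (hg : g.Below W) {S : Finset ℕ}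
    (hS : SetBelow W S) : SetBelow W (g.perm conv f S) := by
  cases g with
  | X w => exact setBelow_flipWire hS hg
  | H w => exact hS
  | T w => exact hS
  | CNOT c t h =>
    dsimp only [perm]
    split_ifs
    · exact setBelow_flipWire hS hg.2
    · exact hS
  | CCNOT c d t hcd hct hdt =>
    dsimp only [perm]
    split_ifs
    · exact setBelow_flipWire hS hg.2.2
    · exact hS
  | query x y h => exact setBelow_writeReg hS hg.2 _

theorem Gate.setBelow_permInv {W : ℕ} {g : Gate a b} (hg : g.Below W) {S : Finset ℕ}
    (hS : SetBelow W S) : SetBelow W (g.permInv conv f S) := by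
  cases g with
  | query x y h => exact setBelow_writeReg hS hg.2 _
  | X w => exact Gate.setBelow_perm (conv := conv) (f := f) hg hS
  | H w => exact hS
  | T w => exact hS
  | CNOT c t h => exact Gate.setBelow_perm (conv := conv) (f := f) hg hS
  | CCNOT c d t h₁ h₂ h₃ => exact Gate.setBelow_perm (conv := conv) (f := f) hg hS

/-- The state is a superposition of basis states in which only wires below `W` hold `1`. -/
def StateBelow (W : ℕ) (ψ : State) : Prop := ∀ S, ψ S ≠ 0 → SetBelow W S

theorem Gate.stateBelow_apply {W : ℕ} {g : Gate a b} (hg : g.Below W) {ψ : State}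
    (hψ : StateBelow W ψ) : StateBelow W (g.apply conv f ψ) := by
  intro S hS
  by_cases hc : g.IsClassical
  · rw [Gate.apply_of_isClassical_apply conv f hc] at hS
    have := Gate.setBelow_perm (conv := conv) (f := f) hg (hψ _ hS)
    rwa [Gate.perm_permInv] at this
  · cases g with
    | H w =>
      rw [Gate.apply_H_apply] at hS
      have : ψ (S.erase w) ≠ 0 ∨ ψ (insert w S) ≠ 0 := by
        by_contra! h
        simp [h.1, h.2] at hS
      intro k hk
      by_cases hkw : k = w
      · rw [hkw]; exact hg
      · rcases this with h | h
        · exact hψ _ h k (by simp [hkw, hk])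
        · exact hψ _ h k (by simp [hk])
    | T w =>
      rw [Gate.apply_T_apply] at hS
      exact hψ S (right_ne_zero_of_mul hS)
    | X w => exact absurd trivial hc
    | CNOT c t h => exact absurd trivial hc
    | CCNOT c d t h₁ h₂ h₃ => exact absurd trivial hc
    | query x y h => exact absurd trivial hc

/-! ### Unitarity -/

/-- The squared norm of the part of a state on the wires below `W`. -/
noncomputable def normSqBelow (W : ℕ) (ψ : State) : ℝ := ∑ S ∈ (Finset.range W).powerset, ‖ψ S‖ ^ 2

theorem mem_powerset_range {W : ℕ} {S : Finset ℕ} :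
    S ∈ (Finset.range W).powerset ↔ SetBelow W S := by
  simp [SetBelow, Finset.subset_iff]

/-- Classical gates permute the basis states below `W`, and `T` multiplies amplitudes by phases. `H`
mixes the states `S` and `insert w S` in pairs, and the parallelogram law preserves the weight of
each pair. -/
theorem Gate.normSqBelow_apply {W : ℕ} {g : Gate a b} (hg : g.Below W) (ψ : State) :
    normSqBelow W (g.apply conv f ψ) = normSqBelow W ψ := by
  by_cases hc : g.IsClassical
  · refine Finset.sum_nbij' (g.permInv conv f) (g.perm conv f) ?_ ?_ ?_ ?_ ?_
    · exact fun S hS => mem_powerset_range.mpr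
        (Gate.setBelow_permInv hg (mem_powerset_range.mp hS))
    · exact fun S hS => mem_powerset_range.mpr (Gate.setBelow_perm hg (mem_powerset_range.mp hS))
    · exact fun S _ => g.perm_permInv conv f S
    · exact fun S _ => g.permInv_perm conv f S
    · exact fun S _ => by rw [Gate.apply_of_isClassical_apply conv f hc]
  · cases g with
    | H w =>
      unfold normSqBelow
      have hw : w ∈ Finset.range W := Finset.mem_range.mpr hg
      rw [← Finset.insert_erase hw, Finset.sum_powerset_insert (Finset.notMem_erase _ _),
        Finset.sum_powerset_insert (Finset.notMem_erase _ _), ← Finset.sum_add_distrib,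
        ← Finset.sum_add_distrib]
      refine Finset.sum_congr rfl fun S hS => ?_
      have hwS : w ∉ S := fun h => by simpa using Finset.mem_powerset.mp hS h
      rw [Gate.apply_H_apply, Gate.apply_H_apply]
      simp only [hwS, if_false, Finset.erase_eq_of_notMem, not_false_eq_true,
        Finset.mem_insert_self, if_true, Finset.erase_insert, Finset.insert_idem, one_mul,
        norm_mul, mul_pow, neg_mul, ← sub_eq_add_neg]
      have h2 : ‖((1 / Real.sqrt 2 : ℝ) : ℂ)‖ ^ 2 = 1 / 2 := by
        rw [Complex.norm_real, Real.norm_eq_abs, sq_abs, div_pow, Real.sq_sqrt (by norm_num)]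
        norm_num
      have := parallelogram_law_with_norm ℝ (ψ S) (ψ (insert w S))
      rw [h2]
      nlinarith [this]
    | T w =>
      refine Finset.sum_congr rfl fun S _ => ?_
      rw [Gate.apply_T_apply, norm_mul]
      have : ‖(if w ∈ S then Complex.exp (Complex.I * Real.pi / 4) else 1 : ℂ)‖ = 1 := by
        split_ifs
        · rw [show Complex.I * Real.pi / 4 = ((Real.pi / 4 : ℝ) : ℂ) * Complex.I by
            push_cast; ring]
          exact Complex.norm_exp_ofReal_mul_I _
        · simp
      rw [this, one_mul]
    | X w => exact absurd trivial hc
    | CNOT c t h => exact absurd trivial hc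
    | CCNOT c d t h₁ h₂ h₃ => exact absurd trivial hc
    | query x y h => exact absurd trivial hc

theorem foldl_apply_below {W : ℕ} (C : Circuit a b) (hC : ∀ g ∈ C, g.Below W) : ∀ ψ : State,
    StateBelow W ψ →
      StateBelow W (C.foldl (fun ψ g => g.apply conv f ψ) ψ) ∧
      normSqBelow W (C.foldl (fun ψ g => g.apply conv f ψ) ψ) = normSqBelow W ψ := by
  induction C with
  | nil => exact fun ψ h => ⟨h, rfl⟩
  | cons g C ih =>
    intro ψ h
    have hg := hC g (by simp)
    obtain ⟨h1, h2⟩ := ih (fun g' hg' => hC g' (by simp [hg'])) _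
      (Gate.stateBelow_apply (conv := conv) (f := f) hg h)
    exact ⟨h1, h2.trans (Gate.normSqBelow_apply hg ψ)⟩

theorem stateBelow_finalState {W : ℕ} {C : Circuit a b} (hC : ∀ g ∈ C, g.Below W) :
    StateBelow W (finalState conv f C) := by
  refine (foldl_apply_below C hC _ fun S hS => ?_).1
  have : S = ∅ := by
    by_contra h
    exact hS (Finsupp.single_eq_of_ne h)
  simp [this, SetBelow]

theorem normSqBelow_finalState {W : ℕ} {C : Circuit a b} (hC : ∀ g ∈ C, g.Below W) :
    normSqBelow W (finalState conv f C) = 1 := by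
  refine (foldl_apply_below C hC _ fun S hS => ?_).2.trans ?_
  · have : S = ∅ := by
      by_contra h
      exact hS (Finsupp.single_eq_of_ne h)
    simp [this, SetBelow]
  · unfold normSqBelow
    rw [Finset.sum_eq_single ∅]
    · simp
    · intro S _ hS
      simp [Finsupp.single_eq_of_ne hS]
    · simp

-- The support of the final state depends on the oracle. A fixed finite index set allows sums over
-- outcomes and over oracles to be exchanged.
open Classical in
theorem outcomeProb_eq_sum {W : ℕ} {C : Circuit a b} (hC : ∀ g ∈ C, g.Below W)
    (E : Finset ℕ → Prop) : outcomeProb conv f C E =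
      ∑ S ∈ (Finset.range W).powerset, if E S then ‖finalState conv f C S‖ ^ 2 else 0 := by
  unfold outcomeProb
  refine Finsupp.sum_of_support_subset _ (fun S hS => ?_) _ (by simp)
  exact mem_powerset_range.mpr (stateBelow_finalState hC S (Finsupp.mem_support_iff.mp hS))

end Gates

/-! ### Functions that depend on few values of the oracle -/

section Local

variable {X Y : Type*}

/-- The span of the functions of `H : X → Y` that depend on at most `q` values of `H`. -/
def localFun (X Y : Type*) (q : ℕ) : Submodule ℂ ((X → Y) → ℂ) :=
  Submodule.span ℂ {F | ∃ T : Finset X, T.card ≤ q ∧ DependsOn F (T : Set X)}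

theorem const_mem_localFun (q : ℕ) (c : ℂ) : (fun _ => c) ∈ localFun X Y q :=
  Submodule.subset_span ⟨∅, by simp, fun _ _ _ => rfl⟩

-- For a function depending on `T`, the extra test makes the product depend on `insert x T`;
-- linearity does the rest. This is the cost of one query.
open Classical in
theorem ite_mem_localFun {q : ℕ} {Φ : (X → Y) → ℂ} (hΦ : Φ ∈ localFun X Y q) (x : X) (v : Y) :
    (fun H => if H x = v then Φ H else 0) ∈ localFun X Y (q + 1) := by
  induction hΦ using Submodule.span_induction with
  | mem F hF =>
    obtain ⟨T, hT, hF⟩ := hF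
    refine Submodule.subset_span ⟨insert x T, (Finset.card_insert_le _ _).trans (by omega), ?_⟩
    intro H H' h
    have h1 : H x = H' x := h x (by simp)
    have h2 : F H = F H' := hF fun y hy => h y (by simp [Finset.mem_coe.mp hy])
    simp only [h1, h2]
  | zero =>
    convert (localFun X Y (q + 1)).zero_mem using 1
    funext H
    simp
  | add F G _ _ hF hG =>
    convert add_mem hF hG using 1
    funext H
    by_cases h : H x = v <;> simp [h]
  | smul c F _ hF =>
    convert Submodule.smul_mem _ c hF using 1
    funext H
    by_cases h : H x = v <;> simp [h]

variable [Fintype Y]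

/-- Sum over the coordinate `i` first: `K` is constant there and factors out. -/
theorem sum_mul_eq_zero {ι : Type*} [Fintype ι] [DecidableEq ι] (i : ι) (u : Y → ℂ)
    (hu : ∑ y, u y = 0) (K : (ι → Y) → ℂ) (hK : DependsOn K {i}ᶜ) :
    ∑ h : ι → Y, u (h i) * K h = 0 := by
  rcases isEmpty_or_nonempty Y with hY | ⟨⟨y₀⟩⟩
  · have : IsEmpty (ι → Y) := ⟨fun h => hY.false (h i)⟩
    simp
  rw [← (Equiv.funSplitAt i Y).symm.sum_comp, Fintype.sum_prod_type, Finset.sum_comm]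
  refine Finset.sum_eq_zero fun r _ => ?_
  have : ∀ y, u ((Equiv.funSplitAt i Y).symm (y, r) i) * K ((Equiv.funSplitAt i Y).symm (y, r)) =
      u y * K ((Equiv.funSplitAt i Y).symm (y₀, r)) := fun y => by
    congr 1
    · simp
    · refine hK fun j hj => ?_
      have : j ≠ i := hj
      simp [this]
  rw [Finset.sum_congr rfl fun y _ => this y, ← Finset.sum_mul, hu, zero_mul]

theorem card_pos_of_elem (t : Y) : (0 : ℝ) < Fintype.card Y :=
  Nat.cast_pos.mpr (Fintype.card_pos_iff.mpr ⟨t⟩)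

/-! ### Centred indicators and the weight at a point -/

variable [DecidableEq Y]

/-- The indicator function of `t`, made orthogonal to the constant functions. -/
noncomputable def centred (t y : Y) : ℝ := (if y = t then 1 else 0) - 1 / Fintype.card Y

theorem sum_centred (t : Y) : ∑ y, centred t y = 0 := by
  have := card_pos_of_elem t
  simp [centred, this.ne']

/-- The value is also `centred t t`, because centring is an orthogonal projection applied to the
indicator of `t`. -/
theorem sum_centred_sq (t : Y) : ∑ y, centred t y ^ 2 = 1 - 1 / Fintype.card Y := by
  have h := card_pos_of_elem t
  have : ∀ y, centred t y ^ 2 = (if y = t then 1 - 2 / (Fintype.card Y : ℝ) else 0) +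
      1 / (Fintype.card Y : ℝ) ^ 2 := fun y => by
    unfold centred
    split_ifs <;> ring
  rw [Finset.sum_congr rfl fun y _ => this y, Finset.sum_add_distrib, Finset.sum_ite_eq']
  simp only [Finset.mem_univ, if_true, Finset.sum_const, Finset.card_univ, nsmul_eq_mul]
  field_simp
  ring

/-- A function that is orthogonal to the product of the centred indicator functions has little of
its weight at `t`. -/
theorem norm_sq_apply_le {ι : Type*} [Fintype ι] [DecidableEq ι] (t : ι → Y) (φ : (ι → Y) → ℂ)
    (h : ∑ x : ι → Y, ((∏ i, centred (t i) (x i) : ℝ) : ℂ) * φ x = 0) :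
    ‖φ t‖ ^ 2 ≤ Fintype.card ι / Fintype.card Y * ∑ x, ‖φ x‖ ^ 2 := by
  set w : (ι → Y) → ℝ := fun x => ∏ i, centred (t i) (x i) with hw
  set c : (ι → Y) → ℝ := fun x => (if x = t then 1 else 0) - w x with hc
  -- Evaluation at `t` is pairing with `δ_t`. By orthogonality `w` may be subtracted from `δ_t`,
  -- which leaves a vector of small norm.
  have h1 : φ t = ∑ x, (c x : ℂ) * φ x := by
    simp only [hc, Complex.ofReal_sub, sub_mul, Finset.sum_sub_distrib]
    rw [h, sub_zero, Finset.sum_eq_single t (fun x _ hx => by simp [hx]) (by simp)]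
    simp
  rcases isEmpty_or_nonempty ι with hι | ⟨⟨i₀⟩⟩
  · have : ∀ x, c x = 0 := fun x => by simp [hc, hw, Subsingleton.elim x t]
    rw [h1]; simp [this]
  have hN := card_pos_of_elem (t i₀)
  set N : ℝ := ((Fintype.card Y : ℕ) : ℝ) with hNdef
  set k := Fintype.card ι with hk
  have hwt : w t = (1 - 1 / N) ^ k := by
    simp [hw, centred, hk, hNdef]
  have hw2 : ∑ x, w x ^ 2 = (1 - 1 / N) ^ k := by
    have := Finset.prod_univ_sum (fun _ : ι => (Finset.univ : Finset Y))
      (fun i y => centred (t i) y ^ 2)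
    simp only [sum_centred_sq, Finset.prod_const, Finset.card_univ, Fintype.piFinset_univ] at this
    rw [hk, hNdef, this]
    simp [hw, Finset.prod_pow]
  -- Expanding `‖δ_t - w‖²` gives `1 - 2 w(t) + ‖w‖²`, and `‖w‖² = w(t)`.
  have hc2 : ∑ x, c x ^ 2 = 1 - (1 - 1 / N) ^ k := by
    have : ∀ x, c x ^ 2 = (if x = t then 1 - 2 * w t else 0) + w x ^ 2 := fun x => by
      simp only [hc]
      split_ifs with hx
      · subst hx; ring
      · ring
    rw [Finset.sum_congr rfl fun x _ => this x, Finset.sum_add_distrib, Finset.sum_ite_eq', hw2,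
      hwt]
    simp; ring
  have hb : 1 - (1 - 1 / N) ^ k ≤ k / N := by
    have hN1 : 1 ≤ N := by
      rw [hNdef]; exact_mod_cast Fintype.card_pos_iff.mpr ⟨t i₀⟩
    -- Bernoulli's inequality.
    have := one_add_mul_sub_le_pow (a := 1 - 1 / N)
      (by have : 1 / N ≤ 1 := (div_le_one hN).mpr hN1
          linarith) k
    have e : (k : ℝ) * (1 - 1 / N - 1) = -(k / N) := by ring
    rw [e] at this
    linarith
  calc ‖φ t‖ ^ 2 ≤ (∑ x, |c x| * ‖φ x‖) ^ 2 := by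
        gcongr
        rw [h1]
        refine (norm_sum_le _ _).trans_eq (Finset.sum_congr rfl fun x _ => ?_)
        simp
    _ ≤ (∑ x, |c x| ^ 2) * ∑ x, ‖φ x‖ ^ 2 := Finset.sum_mul_sq_le_sq_mul_sq _ _ _
    _ ≤ _ := by
        gcongr
        simp only [sq_abs]
        rw [hc2]; exact hb

variable [Fintype X] [DecidableEq X]

open Classical in
/-- If `Φ` is a combination of functions that depend on at most `q` values of `H`, then only a small
part of its weight is on the `H` with prescribed values at more than `q` places. -/
theorem sum_norm_sq_le {q : ℕ} {Φ : (X → Y) → ℂ} (hΦ : Φ ∈ localFun X Y q) (M : Finset X)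
    (hM : q < M.card) (t : X → Y) :
    ∑ H : X → Y, (if ∀ x ∈ M, H x = t x then ‖Φ H‖ ^ 2 else 0) ≤
      M.card / Fintype.card Y * ∑ H, ‖Φ H‖ ^ 2 := by
  -- `H` is split into its restriction `h` to `M` and its restriction `r` to the complement, which
  -- stays fixed below.
  set e := (Equiv.piEquivPiSubtypeProd (· ∈ M) fun _ : X => Y).symm with he
  have e1 : ∀ h r x (hx : x ∈ M), e (h, r) x = h ⟨x, hx⟩ := fun h r x hx => by simp [he, hx]
  have e2 : ∀ h r x (hx : x ∉ M), e (h, r) x = r ⟨x, hx⟩ := fun h r x hx => by simp [he, hx]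
  have orth : ∀ r, ∑ h : {x // x ∈ M} → Y,
      ((∏ i : {x // x ∈ M}, centred (t i) (h i) : ℝ) : ℂ) * Φ (e (h, r)) = 0 := by
    intro r
    induction hΦ using Submodule.span_induction with
    | mem F hF =>
      obtain ⟨T, hT, hF⟩ := hF
      -- `F` sees at most `q` points, so some `x ∈ M` escapes it. Only the factor `centred (t x)`
      -- then depends on `h x`, and it sums to zero.
      obtain ⟨x, hxM, hxT⟩ := Finset.exists_mem_notMem_of_card_lt_card (hT.trans_lt hM)
      have := sum_mul_eq_zero (⟨x, hxM⟩ : {x // x ∈ M}) (fun y => (centred (t x) y : ℂ))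
        (by rw [← Complex.ofReal_sum, sum_centred, Complex.ofReal_zero])
        (fun h => ((∏ i ∈ (Finset.univ : Finset {x // x ∈ M}).erase ⟨x, hxM⟩, centred (t i) (h i) : ℝ) : ℂ) *
          F (e (h, r))) (fun h h' hh => ?_)
      · rw [← this]
        refine Finset.sum_congr rfl fun h _ => ?_
        rw [← mul_assoc, ← Complex.ofReal_mul,
          Finset.mul_prod_erase _ (fun i : {x // x ∈ M} => centred (t i) (h i))
            (Finset.mem_univ (⟨x, hxM⟩ : {x // x ∈ M}))]
      · have hA : ∀ i ∈ (Finset.univ : Finset {x // x ∈ M}).erase ⟨x, hxM⟩,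
            centred (t i) (h i) = centred (t i) (h' i) := fun i hi => by
          rw [hh i (Finset.ne_of_mem_erase hi)]
        have hB : F (e (h, r)) = F (e (h', r)) := hF fun y hy => by
          have hyx : y ≠ x := fun e => hxT (e ▸ hy)
          by_cases hyM : y ∈ M
          · rw [e1 _ _ _ hyM, e1 _ _ _ hyM]
            exact hh _ (by simpa using hyx)
          · rw [e2 _ _ _ hyM, e2 _ _ _ hyM]
        dsimp only
        rw [hB, Finset.prod_congr rfl hA]
    | zero => simp
    | add F G _ _ hF hG =>
      simp only [Pi.add_apply, mul_add, Finset.sum_add_distrib, hF, hG, add_zero]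
    | smul c F _ hF =>
      simp only [Pi.smul_apply, smul_eq_mul, mul_left_comm _ c, ← Finset.mul_sum, hF, mul_zero]
  -- For each `r` exactly one `h` meets the prescribed values, so the estimate for a single point
  -- applies slice by slice.
  rw [← e.sum_comp, ← e.sum_comp, Fintype.sum_prod_type, Fintype.sum_prod_type, Finset.sum_comm,
    Finset.sum_comm (γ := {x // x ∈ M} → Y), Finset.mul_sum]
  refine Finset.sum_le_sum fun r _ => ?_
  have hcond : ∀ h, (∀ x ∈ M, e (h, r) x = t x) ↔ h = fun x : {x // x ∈ M} => t x := fun h => by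
    constructor
    · intro H
      funext ⟨x, hx⟩
      rw [← H x hx, e1 _ _ _ hx]
    · rintro rfl x hx
      rw [e1 _ _ _ hx]
  simp only [hcond, Finset.sum_ite_eq', Finset.mem_univ, if_true]
  have := norm_sq_apply_le (fun x : {x // x ∈ M} => t x) (fun h => Φ (e (h, r))) (orth r)
  simpa using this

end Local

/-! ### Amplitudes as functions of the oracle -/

section Amplitudes

variable {a b : ℕ} {conv : QueryConvention}

/-- All gates other than queries act on amplitudes by linear formulas independent of `H`; only
queries raise the locality, each by one. -/
theorem foldl_apply_mem_localFun (C : Circuit a b) :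
    ∀ (q : ℕ) (Ψ : (BitVec a → BitVec b) → State), (∀ S, (fun H => Ψ H S) ∈ localFun _ _ q) →
      ∀ S, (fun H => C.foldl (fun ψ g => g.apply conv H ψ) (Ψ H) S) ∈
        localFun _ _ (q + queryCount C) := by
  induction C with
  | nil => exact fun q Ψ h => h
  | cons g C ih =>
    intro q Ψ h
    have hq : q + queryCount (g :: C) = q + (if g.isQuery then 1 else 0) + queryCount C := by
      simp only [queryCount, List.countP_cons]; omega
    rw [hq]
    refine ih _ (fun H => g.apply conv H (Ψ H)) fun S => ?_
    cases g with
    | H w =>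
      simp only [Gate.apply_H_apply]
      exact Submodule.smul_mem _ _ (add_mem (h _) (Submodule.smul_mem _ _ (h _)))
    | T w =>
      simp only [Gate.apply_T_apply]
      exact Submodule.smul_mem _ _ (h _)
    | X w =>
      simp only [Gate.apply_of_isClassical_apply _ _ (g := Gate.X w) trivial]
      exact h _
    | CNOT c t h₁ =>
      simp only [Gate.apply_of_isClassical_apply _ _ (g := Gate.CNOT c t h₁) trivial]
      exact h _
    | CCNOT c d t h₁ h₂ h₃ =>
      simp only [Gate.apply_of_isClassical_apply _ _ (g := Gate.CCNOT c d t h₁ h₂ h₃) trivial]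
      exact h _
    | query x y hxy =>
      simp only [Gate.apply_of_isClassical_apply _ _ (g := Gate.query x y hxy) trivial]
      -- For fixed `S` the preimage under the query depends on `H` only through its value at the
      -- point `readReg S x`; the sum runs over the candidates `v` for that value.
      have : (fun H : BitVec a → BitVec b => Ψ H ((Gate.query x y hxy).permInv conv H S)) =
          ∑ v : BitVec b, fun H => if H (readReg S x) = v then
            Ψ H (writeReg S y (conv.uncombine (readReg S y) v)) else 0 := by
        funext H
        simp [Gate.permInv]
      rw [this]
      refine sum_mem fun v _ => ?_
      convert ite_mem_localFun (h (writeReg S y (conv.uncombine (readReg S y) v))) (readReg S x) v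
      simp [Gate.isQuery]

theorem finalState_mem_localFun (C : Circuit a b) (S : Finset ℕ) :
    (fun H => finalState conv H C S) ∈ localFun _ _ (queryCount C) := by
  have := foldl_apply_mem_localFun (conv := conv) C 0 (fun _ => Finsupp.single ∅ 1)
    (fun S => const_mem_localFun 0 _) S
  rwa [zero_add] at this

/-- A circuit with fewer than `p` queries to a random function outputs `p` distinct values of it
with probability at most `p / |Y|`. -/
theorem sum_outcomeProb_le (C : Circuit a b) (W p : ℕ) (hC : ∀ g ∈ C, g.Below W)
    (hp : queryCount C < p) (out : Finset ℕ → Fin p → BitVec a × BitVec b) :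
    ∑ H : BitVec a → BitVec b, outcomeProb conv H C
        (fun S => Function.Injective (out S) ∧ ∀ i, H (out S i).1 = (out S i).2) ≤
      p / Fintype.card (BitVec b) * Fintype.card (BitVec a → BitVec b) := by
  classical
  simp only [outcomeProb_eq_sum hC]
  rw [Finset.sum_comm]
  calc _ ≤ ∑ S ∈ (Finset.range W).powerset, p / Fintype.card (BitVec b) *
        ∑ H : BitVec a → BitVec b, ‖finalState conv H C S‖ ^ 2 := by
        refine Finset.sum_le_sum fun S _ => ?_
        -- An outcome consistent with no function contributes nothing. Otherwise distinct pairs have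
        -- distinct messages, so `p` values of `H` are prescribed.
        by_cases hE : Function.Injective (out S) ∧ ∃ t : BitVec a → BitVec b,
            ∀ i, t (out S i).1 = (out S i).2
        · obtain ⟨hinj, t, ht⟩ := hE
          have hinj' : Function.Injective fun i => (out S i).1 := fun i j hij =>
            hinj (Prod.ext hij (by rw [← ht i, ← ht j]; exact congrArg t hij))
          set M : Finset (BitVec a) := Finset.univ.image fun i => (out S i).1 with hM
          have hMc : M.card = p := by
            rw [hM, Finset.card_image_of_injective _ hinj']; simp
          have := sum_norm_sq_le (finalState_mem_localFun (conv := conv) C S) M (hMc ▸ hp) t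
          rw [hMc] at this
          refine le_trans (le_of_eq (Finset.sum_congr rfl fun H _ => ?_)) this
          have : (∀ x ∈ M, H x = t x) ↔ ∀ i, H (out S i).1 = (out S i).2 := by
            simp [hM, ht]
          simp only [this, hinj, true_and]
        · refine le_trans (Finset.sum_nonpos fun H _ => ?_) (by positivity)
          rw [if_neg]
          exact fun h => hE ⟨h.1, H, h.2⟩
    -- For every single oracle the weights of all outcomes sum to `1`.
    _ = p / Fintype.card (BitVec b) * ∑ H : BitVec a → BitVec b,
        normSqBelow W (finalState conv H C) := by
        rw [← Finset.mul_sum, Finset.sum_comm]; rfl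
    _ = _ := by
        simp [normSqBelow_finalState hC]

end Amplitudes

/-! ### Classical circuits -/

section Classical

variable {a b : ℕ} (conv : QueryConvention) (f : BitVec a → BitVec b)

/-- The action of a circuit of classical gates on the basis states. -/
def runPerm (C : Circuit a b) (S : Finset ℕ) : Finset ℕ := C.foldl (fun S g => g.perm conv f S) S

@[simp] theorem runPerm_nil (S : Finset ℕ) : runPerm conv f ([] : Circuit a b) S = S := rfl

@[simp] theorem runPerm_cons (g : Gate a b) (C : Circuit a b) (S : Finset ℕ) :
    runPerm conv f (g :: C) S = runPerm conv f C (g.perm conv f S) := rfl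

@[simp] theorem runPerm_append (C D : Circuit a b) (S : Finset ℕ) :
    runPerm conv f (C ++ D) S = runPerm conv f D (runPerm conv f C S) := List.foldl_append

theorem runPerm_injective (C : Circuit a b) : Function.Injective (runPerm conv f C) := by
  induction C with
  | nil => exact Function.injective_id
  | cons g C ih => exact ih.comp (g.perm_injective conv f)

theorem foldl_apply_of_isClassical (C : Circuit a b) (hC : ∀ g ∈ C, g.IsClassical) : ∀ ψ : State,
    C.foldl (fun ψ g => g.apply conv f ψ) ψ = ψ.mapDomain (runPerm conv f C) := by
  induction C with
  | nil => exact fun ψ => Finsupp.mapDomain_id.symm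
  | cons g C ih =>
    intro ψ
    rw [List.foldl_cons, ih (fun g' hg' => hC g' (by simp [hg'])),
      Gate.apply_of_isClassical conv f (hC g (by simp)), ← Finsupp.mapDomain_comp]
    rfl

/-- Postprocessing the outcome by a classical circuit. -/
theorem outcomeProb_append (C D : Circuit a b) (hD : ∀ g ∈ D, g.IsClassical)
    (E : Finset ℕ → Prop) :
    outcomeProb conv f (C ++ D) E = outcomeProb conv f C fun S => E (runPerm conv f D S) := by
  classical
  unfold outcomeProb finalState
  rw [List.foldl_append, foldl_apply_of_isClassical conv f D hD,
    Finsupp.sum_mapDomain_index_inj (runPerm_injective conv f D)]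

open Classical in
theorem outcomeProb_congr {W : ℕ} {C : Circuit a b} (hC : ∀ g ∈ C, g.Below W)
    {E F : Finset ℕ → Prop} (h : ∀ S, SetBelow W S → (E S ↔ F S)) :
    outcomeProb conv f C E = outcomeProb conv f C F := by
  rw [outcomeProb_eq_sum hC, outcomeProb_eq_sum hC]
  refine Finset.sum_congr rfl fun S hS => ?_
  simp only [h S (mem_powerset_range.mp hS)]

/-- On basis states without wires `≥ lo`, the circuit only writes on wires in `[lo, hi)`, and
then every state that agrees with the result below `hi` satisfies `R`. -/
def Block (lo hi : ℕ) (C : Circuit a b) (R : Finset ℕ → Prop) : Prop :=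
  ∀ S, SetBelow lo S → SetBelow hi (runPerm conv f C S) ∧
    ∀ T : Finset ℕ, (∀ w, w < hi → (w ∈ T ↔ w ∈ runPerm conv f C S)) →
      (∀ w, w < lo → (w ∈ T ↔ w ∈ S)) ∧ R T

variable {conv f}

theorem SetBelow.mono {V W : ℕ} {S : Finset ℕ} (h : SetBelow V S) (hVW : V ≤ W) : SetBelow W S :=
  fun w hw => (h w hw).trans_le hVW

namespace Block

variable {lo mid hi : ℕ} {C D : Circuit a b} {R R' : Finset ℕ → Prop}

/-- The second block leaves the wires below `mid` alone. As `R` is guaranteed for every state that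
agrees there with the first result, it persists. -/
theorem append (h : Block conv f lo mid C R) (h' : Block conv f mid hi D R') :
    Block conv f lo hi (C ++ D) fun T => R T ∧ R' T := by
  intro S hS
  obtain ⟨h1, h2⟩ := h S hS
  obtain ⟨h3, h4⟩ := h' _ h1
  rw [runPerm_append]
  refine ⟨h3, fun T hT => ?_⟩
  obtain ⟨h5, h6⟩ := h4 T hT
  obtain ⟨h7, h8⟩ := h2 T h5
  exact ⟨h7, h8, h6⟩

theorem mono {lo' hi' : ℕ} (h : Block conv f lo hi C R) (hlo : lo' ≤ lo) (hhi : hi ≤ hi')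
    (hR : ∀ T, R T → R' T) : Block conv f lo' hi' C R' := by
  intro S hS
  obtain ⟨h1, h2⟩ := h S (hS.mono hlo)
  refine ⟨h1.mono hhi, fun T hT => ?_⟩
  obtain ⟨h3, h4⟩ := h2 T fun w hw => hT w (by omega)
  exact ⟨fun w hw => h3 w (by omega), hR T h4⟩

theorem loop {C : ℕ → Circuit a b} {R : ℕ → Finset ℕ → Prop} (l : ℕ → ℕ) (N : ℕ)
    (h : ∀ i, i < N → Block conv f (l i) (l (i + 1)) (C i) (R i)) :
    Block conv f (l 0) (l N) ((List.range N).flatMap C) fun T => ∀ i, i < N → R i T := by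
  induction N with
  | zero => exact fun S hS => ⟨by simpa using hS, fun T hT => ⟨by simpa using hT, by simp⟩⟩
  | succ N ih =>
    rw [Text.flatMap_range_succ]
    refine ((ih fun i hi => h i (by omega)).append (h N (by omega))).mono le_rfl le_rfl ?_
    rintro T ⟨h1, h2⟩ i hi
    rcases Nat.lt_succ_iff_lt_or_eq.mp hi with h | rfl
    · exact h1 i h
    · exact h2

/-- A circuit that flips a fresh wire under a condition on the lower ones. -/
theorem of_flip {d : ℕ} (P : Finset ℕ → Prop) [DecidablePred P]
    (hC : ∀ S, runPerm conv f C S = if P S then flipWire S d else S)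
    (hP : ∀ S T : Finset ℕ, (∀ w, w < d → (w ∈ S ↔ w ∈ T)) → (P S ↔ P T)) :
    Block conv f d (d + 1) C fun T => d ∈ T ↔ P T := by
  intro S hS
  have hd : d ∉ S := fun h => lt_irrefl d (hS d h)
  have key : ∀ w, w ∈ runPerm conv f C S ↔ if w = d then P S else w ∈ S := by
    intro w
    rw [hC]
    by_cases hw : w = d <;> by_cases hp : P S <;> simp [mem_flipWire, hw, hp, hd]
  refine ⟨fun w hw => ?_, fun T hT => ?_⟩
  · rw [key] at hw
    by_cases h : w = d
    · omega
    · exact (hS w (by simpa [h] using hw)).trans (Nat.lt_succ_self d)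
  · have h1 : ∀ w, w < d → (w ∈ T ↔ w ∈ S) := fun w hw => by
      rw [hT w (by omega), key, if_neg (by omega)]
    exact ⟨h1, show d ∈ T ↔ P T by rw [hT d (by omega), key, if_pos rfl, hP S T fun w hw => (h1 w hw).symm]⟩

end Block

/-! ### The circuit that checks message-tag pairs -/

/-- A controlled-not gate. -/
def cnot (c t : ℕ) : Circuit a b := if h : c ≠ t then [.CNOT c t h] else []

/-- A Toffoli gate. -/
def ccnot (c d t : ℕ) : Circuit a b :=
  if h : c ≠ d ∧ c ≠ t ∧ d ≠ t then [.CCNOT c d t h.1 h.2.1 h.2.2] else []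

/-- The register of `w` consecutive wires starting with `x`. -/
def wires (w x : ℕ) : Fin w ↪ ℕ := ⟨fun i => x + i.val, fun _ _ h => Fin.ext (Nat.add_left_cancel h)⟩

/-- A query whose registers consist of consecutive wires, starting from `x` and `y`. -/
def queryAt (x y : ℕ) : Circuit a b :=
  if h : ∀ i j, wires a x i ≠ wires b y j then [.query (wires a x) (wires b y) h] else []

/-- Flips wire `d` if wire `c` holds `1` and the wires `u` and `v` are equal. -/
def eqStep (u v c d : ℕ) : Circuit a b :=
  cnot u v ++ ([.X v] ++ (ccnot c v d ++ ([.X v] ++ cnot u v)))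

/-- Flips wire `d` if wire `c` holds `1` and wire `e` holds `0`. -/
def andNotStep (c e d : ℕ) : Circuit a b := [.X e] ++ (ccnot c e d ++ [.X e])

theorem block_X (w : ℕ) : Block conv f w (w + 1) ([.X w] : Circuit a b) fun T => w ∈ T :=
  (Block.of_flip (fun _ => True) (fun S => by simp [Gate.perm]) fun _ _ _ => Iff.rfl).mono
    le_rfl le_rfl fun T hT => hT.mpr trivial

theorem block_cnot {c d : ℕ} (hcd : c < d) :
    Block conv f d (d + 1) (cnot c d : Circuit a b) fun T => d ∈ T ↔ c ∈ T :=
  Block.of_flip (fun S => c ∈ S) (fun S => by simp [cnot, hcd.ne, Gate.perm])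
    fun S T h => h c hcd

/-- After the first two gates wire `v` holds the negation of `u ⊕ v`, which tests equality. The last
two gates restore it. -/
theorem block_eqStep {u v c d : ℕ} (hu : u < d) (hv : v < d) (hc : c < d) (huv : u ≠ v)
    (hcv : c ≠ v) : Block conv f d (d + 1) (eqStep u v c d : Circuit a b)
      fun T => d ∈ T ↔ c ∈ T ∧ (u ∈ T ↔ v ∈ T) := by
  refine Block.of_flip (fun S => c ∈ S ∧ (u ∈ S ↔ v ∈ S)) (fun S => ?_)
    fun S T h => by rw [h c hc, h u hu, h v hv]
  have h : c ≠ v ∧ c ≠ d ∧ v ≠ d := ⟨hcv, hc.ne, hv.ne⟩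
  simp only [eqStep, cnot, huv, ne_eq, not_false_eq_true, dite_true, ccnot, h, and_self,
    runPerm_append, runPerm_cons, runPerm_nil, Gate.perm]
  ext k
  have := h.1; have := h.2.1; have := h.2.2; have := hu.ne
  by_cases h1 : u ∈ S <;> by_cases h2 : v ∈ S <;> by_cases h3 : c ∈ S <;>
    by_cases k1 : k = v <;> by_cases k2 : k = d <;> simp_all [mem_flipWire]

theorem block_andNotStep {c e d : ℕ} (hc : c < d) (he : e < d) (hce : c ≠ e) :
    Block conv f d (d + 1) (andNotStep c e d : Circuit a b)
      fun T => d ∈ T ↔ c ∈ T ∧ e ∉ T := by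
  refine Block.of_flip (fun S => c ∈ S ∧ e ∉ S) (fun S => ?_)
    fun S T h => by rw [h c hc, h e he]
  have h : c ≠ e ∧ c ≠ d ∧ e ≠ d := ⟨hce, hc.ne, he.ne⟩
  simp only [andNotStep, ne_eq, not_false_eq_true, dite_true, ccnot, h, and_self,
    runPerm_append, runPerm_cons, runPerm_nil, Gate.perm]
  ext k
  have := h.1; have := h.2.1; have := h.2.2
  by_cases h2 : e ∈ S <;> by_cases h3 : c ∈ S <;>
    by_cases k1 : k = e <;> by_cases k2 : k = d <;> simp_all [mem_flipWire]

theorem wires_ne {x y : ℕ} (h : x + a ≤ y) (i : Fin a) (j : Fin b) : wires a x i ≠ wires b y j :=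
  fun e => by
    have : x + i.val = y + j.val := e
    omega

theorem queryAt_eq {x y : ℕ} (h : x + a ≤ y) :
    (queryAt x y : Circuit a b) = [.query (wires a x) (wires b y) (wires_ne h)] :=
  dif_pos (wires_ne h)

/-- The answer register is fresh, hence zero, so under either convention the query writes the plain
oracle value. -/
theorem block_queryAt {x y : ℕ} (h : x + a ≤ y) :
    Block conv f y (y + b) (queryAt x y : Circuit a b)
      fun T => (readReg T fun j : Fin b => y + j.val) = f (readReg T fun i : Fin a => x + i.val) := by
  intro S hS
  simp only [queryAt_eq h, runPerm_cons, runPerm_nil, Gate.perm]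
  set X := wires a x
  set Y := wires b y
  have hX : ∀ i, X i = x + i.val := fun _ => rfl
  have hY : ∀ j, Y j = y + j.val := fun _ => rfl
  have h0 : readReg S Y = 0 := bitVec_ext fun j => by
    rw [getLsb_readReg]
    have : Y j ∉ S := fun h' => by have := hS _ h'; rw [hY] at this; omega
    simp [this]
  rw [h0, combine_zero]
  set S' := writeReg S Y (f (readReg S X)) with hS'
  have hlow : ∀ w, (w < y ∨ y + b ≤ w) → (w ∈ S' ↔ w ∈ S) := fun w hw =>
    mem_writeReg_of_notMem _ _ _ fun j => by rw [hY]; omega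
  refine ⟨fun w hw => ?_, fun T hT => ⟨fun w hw => ?_, ?_⟩⟩
  · by_contra hwb
    have := hS w ((hlow w (by omega)).mp hw)
    omega
  · rw [hT w (by omega), hlow w (by omega)]
  · have e1 : (readReg T fun j : Fin b => y + j.val) = readReg S' Y :=
      readReg_congr fun j => by rw [hY, hT _ (by omega)]
    have e2 : (readReg T fun i : Fin a => x + i.val) = readReg S X :=
      readReg_congr fun i => by rw [hX, hT _ (by omega), hlow _ (by omega)]
    rw [e1, e2, hS', readReg_writeReg]

/-- The first wire of the `i`-th block of the comparison of messages. -/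
def rowWire (a b p B i : ℕ) : ℕ := B + p * b + p * b + i * (p * (a + 2) + 1)

/-- Compares the messages `i` and `j`, and passes the flag on wire `s` on to wire `s + a + 2` if they
are different. -/
def pairCheck (i j s : ℕ) : Circuit a b :=
  [.X (s + 1)] ++ ((List.range a).flatMap (fun k => eqStep (i * a + k) (j * a + k) (s + 1 + k)
    (s + 2 + k)) ++ andNotStep s (s + 1 + a) (s + a + 2))

/-- The circuit that checks `p` message-tag pairs, with work space from wire `B` on. It asks for the
tags of all messages, compares them with the given ones, and compares the messages with each other.
The final verdict is wire `rowWire a b p B p`. -/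
def checker (p B : ℕ) : Circuit a b :=
  (List.range p).flatMap (fun i => queryAt (i * a) (B + i * b)) ++
  ([.X (B + p * b)] ++
  ((List.range (p * b)).flatMap (fun k => eqStep (p * a + k) (B + k) (B + p * b + k)
    (B + p * b + k + 1)) ++
  (List.range p).flatMap (fun i =>
    (List.range i).flatMap (fun j => pairCheck i j (rowWire a b p B i + j * (a + 2))) ++
      cnot (rowWire a b p B i + i * (a + 2)) (rowWire a b p B (i + 1)))))

/-- Checks `p` message-tag pairs, and puts the verdict on wire `0`. -/
def verifier (p B : ℕ) : Circuit a b :=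
  checker p B ++ (cnot 0 (rowWire a b p B p) ++ cnot (rowWire a b p B p) 0)

/-- A flag passed on from wire to wire collects the conjunction of all tests. -/
theorem forall_chain {x P : ℕ → Prop} {n : ℕ} (h : ∀ k, k < n → (x (k + 1) ↔ x k ∧ P k)) :
    x n ↔ x 0 ∧ ∀ k, k < n → P k := by
  induction n with
  | zero => simp
  | succ n ih =>
    rw [h n (by omega), ih fun k hk => h k (by omega)]
    simp only [Nat.lt_succ_iff_lt_or_eq, or_imp, forall_and, forall_eq, and_assoc]

/-- Wire `s` is the incoming flag and wire `s + a + 2` the outgoing one. In between, wires `s + 1`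
to `s + 1 + a` collect the bitwise equalities of the two messages. -/
theorem block_pairCheck {i j s : ℕ} (hji : j < i) (his : i * a + a ≤ s) :
    Block conv f (s + 1) (s + a + 2 + 1) (pairCheck i j s : Circuit a b) fun T =>
      s + a + 2 ∈ T ↔ s ∈ T ∧ ¬ ∀ k, k < a → (i * a + k ∈ T ↔ j * a + k ∈ T) := by
  have hja : j * a + a ≤ i * a := by
    rw [← Nat.succ_mul]; exact Nat.mul_le_mul_right a hji
  have h1 := Block.loop (conv := conv) (f := f) (fun k => s + 2 + k) a fun k (hk : k < a) =>
    block_eqStep (a := a) (b := b) (conv := conv) (f := f) (u := i * a + k) (v := j * a + k)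
      (c := s + 1 + k) (d := s + 2 + k) (by omega) (by omega) (by omega) (by omega) (by omega)
  have h2 := block_andNotStep (a := a) (b := b) (conv := conv) (f := f) (c := s) (e := s + 1 + a)
    (d := s + a + 2) (by omega) (by omega) (by omega)
  refine (((block_X (s + 1)).mono le_rfl le_rfl fun _ h => h).append (mid := s + 2)
    ((h1.mono le_rfl (hi' := s + a + 2) (by omega) fun _ h => h).append h2)).mono le_rfl le_rfl ?_
  rintro T ⟨g1, g2, g3⟩
  rw [g3]
  have chain := forall_chain (x := fun k => s + 1 + k ∈ T)
    (P := fun k => i * a + k ∈ T ↔ j * a + k ∈ T) (n := a) fun k hk => by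
      rw [show s + 1 + (k + 1) = s + 2 + k by omega]; exact g2 k hk
  rw [chain]
  simp only [add_zero, g1, true_and]

/-- From `B` on there are `p * b` wires for the recomputed tags, then the flag chain of the tag
comparison, whose last wire is `rowWire a b p B 0`, and then one row per message `i` for its
comparison with the earlier ones. -/
theorem block_checker {p B : ℕ} (hB : p * a + p * b ≤ B) :
    Block conv f B (rowWire a b p B p + 1) (checker p B : Circuit a b) fun T =>
      rowWire a b p B p ∈ T ↔
        (∀ i, i < p → (readReg T fun j : Fin b => p * a + i * b + j.val) =
          f (readReg T fun j : Fin a => i * a + j.val)) ∧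
        ∀ i, i < p → ∀ j, j < i → ¬ ∀ k, k < a → (i * a + k ∈ T ↔ j * a + k ∈ T) := by
  have mul_le : ∀ i c : ℕ, i < p → i * c + c ≤ p * c := fun i c hi => by
    rw [← Nat.succ_mul]; exact Nat.mul_le_mul_right c hi
  have h1 := Block.loop (conv := conv) (f := f) (fun i => B + i * b) p fun i hi =>
    (block_queryAt (conv := conv) (f := f) (x := i * a) (y := B + i * b)
      (by have := mul_le i a hi; omega)).mono le_rfl
      (by rw [Nat.succ_mul]; omega : B + i * b + b ≤ B + (i + 1) * b) fun _ h => h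
  have h3 := Block.loop (conv := conv) (f := f) (fun k => B + p * b + k + 1) (p * b)
    fun k (hk : k < p * b) =>
    block_eqStep (a := a) (b := b) (conv := conv) (f := f) (u := p * a + k) (v := B + k)
      (c := B + p * b + k) (d := B + p * b + k + 1) (by omega) (by omega) (by omega) (by omega)
      (by omega)
  -- Row `i` needs only `i * (a + 2)` further wires, but all rows have the same width to keep
  -- addresses polynomial; the final CNOT carries the flag across the unused wires.
  have h4 := Block.loop (conv := conv) (f := f) (fun i => rowWire a b p B i + 1) p fun i hi =>
    ((Block.loop (conv := conv) (f := f) (fun j => rowWire a b p B i + j * (a + 2) + 1) i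
      fun j hj => (block_pairCheck (conv := conv) (f := f) (i := i) (j := j)
        (s := rowWire a b p B i + j * (a + 2)) hj
        (by have := mul_le i a hi; unfold rowWire; omega)).mono le_rfl
        (by rw [Nat.succ_mul]; omega) fun _ h => h).mono
      (lo' := rowWire a b p B i + 1) (hi' := rowWire a b p B (i + 1)) (by simp)
        (by have := mul_le i (a + 2) hi; unfold rowWire; rw [Nat.succ_mul]; omega)
        fun _ h => h).append
      (block_cnot (conv := conv) (f := f) (c := rowWire a b p B i + i * (a + 2))
        (d := rowWire a b p B (i + 1))
        (by have := mul_le i (a + 2) hi; unfold rowWire; rw [Nat.succ_mul]; omega))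
  refine ((h1.mono (lo' := B) (hi' := B + p * b) (by simp) le_rfl fun _ h => h).append
    ((block_X (B + p * b)).append ((h3.mono le_rfl (hi' := rowWire a b p B 0 + 1)
      (by simp [rowWire]) fun _ h => h).append h4))).mono le_rfl le_rfl ?_
  rintro T ⟨g1, g2, g3, g4⟩
  have c1 := forall_chain (x := fun k => B + p * b + k ∈ T)
    (P := fun k => p * a + k ∈ T ↔ B + k ∈ T) (n := p * b) fun k hk => g3 k hk
  have c2 := forall_chain (x := fun i => rowWire a b p B i ∈ T)
    (P := fun i => ∀ j, j < i → ¬ ∀ k, k < a → (i * a + k ∈ T ↔ j * a + k ∈ T)) (n := p)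
    fun i hi => by
      obtain ⟨g5, g6⟩ := g4 i hi
      have := forall_chain (x := fun j => rowWire a b p B i + j * (a + 2) ∈ T)
        (P := fun j => ¬ ∀ k, k < a → (i * a + k ∈ T ↔ j * a + k ∈ T)) (n := i) fun j hj => by
          rw [← g5 j hj, Nat.succ_mul, Nat.add_assoc, Nat.add_assoc]
      rw [g6, this]
      simp
  have e0 : rowWire a b p B 0 = B + p * b + p * b := by simp [rowWire]
  rw [c2, e0, c1]
  simp only [add_zero, g2, true_and]
  refine and_congr_left fun _ => ⟨fun h i hi => ?_, fun h k hk => ?_⟩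
  · rw [← g1 i hi]
    refine readReg_congr fun j => ?_
    have := mul_le i b hi
    rw [Nat.add_assoc, Nat.add_assoc]
    exact h _ (by omega)
  · have hb : 0 < b := Nat.pos_of_ne_zero fun h0 => by simp [h0] at hk
    have hi : k / b < p := Nat.div_lt_of_lt_mul (by rwa [Nat.mul_comm])
    have := h _ hi
    rw [← g1 _ hi, readReg_eq_iff] at this
    have := this ⟨k % b, Nat.mod_lt _ hb⟩
    simpa only [Nat.add_assoc, Nat.div_add_mod'] using this

theorem outputPair_congr {p : ℕ} {S T : Finset ℕ} (h : ∀ w, w < p * a + p * b → (w ∈ T ↔ w ∈ S)) :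
    outputPair a b p T = outputPair a b p S := by
  funext i
  have e1 : i.val * a + a ≤ p * a := by rw [← Nat.succ_mul]; exact Nat.mul_le_mul_right a i.2
  have e2 : i.val * b + b ≤ p * b := by rw [← Nat.succ_mul]; exact Nat.mul_le_mul_right b i.2
  exact Prod.ext (readReg_congr fun j => h _ (by omega)) (readReg_congr fun j => h _ (by omega))

/-- The verifier accepts exactly the outcomes that consist of `p` distinct pairs `(m, f m)`. -/
theorem zero_mem_runPerm_verifier {p B : ℕ} (hB : p * a + p * b ≤ B) (hB0 : 0 < B) {S : Finset ℕ}
    (hS : SetBelow B S) : 0 ∈ runPerm conv f (verifier p B) S ↔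
      Function.Injective (outputPair a b p S) ∧
        ∀ i, f (outputPair a b p S i).1 = (outputPair a b p S i).2 := by
  set T := runPerm conv f (checker p B) S with hT
  obtain ⟨-, h⟩ := block_checker (conv := conv) (f := f) hB S hS
  obtain ⟨h1, h2⟩ := h T fun w _ => Iff.rfl
  have hF : rowWire a b p B p ≠ 0 := by unfold rowWire; omega
  -- Wire `0` may hold a message bit. Adding it to the verdict wire and then adding that wire back
  -- cancels the bit and leaves the verdict on wire `0`.
  have h3 : 0 ∈ runPerm conv f (verifier p B) S ↔ rowWire a b p B p ∈ T := by
    rw [verifier, runPerm_append, ← hT, runPerm_append]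
    simp only [cnot, hF, hF.symm, ne_eq, not_false_eq_true, dite_true, runPerm_cons, runPerm_nil,
      Gate.perm]
    by_cases k1 : 0 ∈ T <;> by_cases k2 : rowWire a b p B p ∈ T <;>
      simp [mem_flipWire, k1, k2, hF.symm]
  rw [h3, h2, ← outputPair_congr fun w hw => h1 w (hw.trans_le hB), and_comm]
  have tags : (∀ i, i < p → (readReg T fun j : Fin b => p * a + i * b + j.val) =
      f (readReg T fun j : Fin a => i * a + j.val)) ↔
      ∀ i : Fin p, f (outputPair a b p T i).1 = (outputPair a b p T i).2 :=
    ⟨fun H i => (H i i.2).symm, fun H i hi => (H ⟨i, hi⟩).symm⟩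
  rw [tags]
  -- Once all tags are correct, pairs are distinct exactly when their messages are.
  refine and_congr_left fun H => ?_
  have eqv : ∀ i j : Fin p, (outputPair a b p T i).1 = (outputPair a b p T j).1 ↔
      ∀ k, k < a → (i * a + k ∈ T ↔ j * a + k ∈ T) := fun i j =>
    readReg_eq_iff.trans ⟨fun h k hk => h ⟨k, hk⟩, fun h k => h k k.2⟩
  constructor
  · intro hne i j hij
    have hm := congrArg Prod.fst hij
    rcases lt_trichotomy i.val j.val with hlt | heq | hgt
    · exact absurd ((eqv j i).mp hm.symm) (hne j j.2 i hlt)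
    · exact Fin.ext heq
    · exact absurd ((eqv i j).mp hm) (hne i i.2 j hgt)
  · intro hinj i hi j hji he
    have hm := (eqv ⟨i, hi⟩ ⟨j, hji.trans hi⟩).mpr he
    have := hinj (Prod.ext hm (by rw [← H, ← H, hm]))
    exact hji.ne' (Fin.mk.inj_iff.mp this)

end Classical

section Verifier

variable {a b : ℕ}

/-! ### The gates of the verifier -/

theorem forall_mem_flatMap {α β : Type*} {P : β → Prop} {l : List α} {F : α → List β}
    (h : ∀ i ∈ l, ∀ g ∈ F i, P g) : ∀ g ∈ l.flatMap F, P g := fun g hg => by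
  obtain ⟨i, hi, hgi⟩ := List.mem_flatMap.mp hg
  exact h i hi g hgi

theorem cnot_isClassical (c t : ℕ) : ∀ g ∈ (cnot c t : Circuit a b), g.IsClassical := by
  unfold cnot
  split_ifs <;> simp [Gate.IsClassical]

theorem ccnot_isClassical (c d t : ℕ) : ∀ g ∈ (ccnot c d t : Circuit a b), g.IsClassical := by
  unfold ccnot
  split_ifs <;> simp [Gate.IsClassical]

theorem queryAt_isClassical (x y : ℕ) : ∀ g ∈ (queryAt x y : Circuit a b), g.IsClassical := by
  unfold queryAt
  split_ifs <;> simp [Gate.IsClassical]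

theorem X_isClassical (w : ℕ) : ∀ g ∈ ([.X w] : Circuit a b), g.IsClassical := by
  simp [Gate.IsClassical]

theorem eqStep_isClassical (u v c d : ℕ) :
    ∀ g ∈ (eqStep u v c d : Circuit a b), g.IsClassical := by
  unfold eqStep
  simp only [List.forall_mem_append]
  exact ⟨cnot_isClassical _ _, X_isClassical _, ccnot_isClassical _ _ _, X_isClassical _,
    cnot_isClassical _ _⟩

theorem pairCheck_isClassical (i j s : ℕ) :
    ∀ g ∈ (pairCheck i j s : Circuit a b), g.IsClassical := by
  unfold pairCheck andNotStep
  simp only [List.forall_mem_append]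
  exact ⟨X_isClassical _, forall_mem_flatMap fun _ _ => eqStep_isClassical _ _ _ _,
    X_isClassical _, ccnot_isClassical _ _ _, X_isClassical _⟩

theorem verifier_isClassical (p B : ℕ) : ∀ g ∈ (verifier p B : Circuit a b), g.IsClassical := by
  unfold verifier checker
  simp only [List.forall_mem_append]
  exact ⟨⟨forall_mem_flatMap fun _ _ => queryAt_isClassical _ _, X_isClassical _,
    forall_mem_flatMap fun _ _ => eqStep_isClassical _ _ _ _,
    forall_mem_flatMap fun i _ => List.forall_mem_append.mpr
      ⟨forall_mem_flatMap fun _ _ => pairCheck_isClassical _ _ _, cnot_isClassical _ _⟩⟩,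
    cnot_isClassical _ _, cnot_isClassical _ _⟩

theorem queryCount_append (C D : Circuit a b) :
    queryCount (C ++ D) = queryCount C + queryCount D := List.countP_append

theorem queryCount_flatMap {N c : ℕ} {F : ℕ → Circuit a b}
    (h : ∀ i, i < N → queryCount (F i) = c) : queryCount ((List.range N).flatMap F) = N * c := by
  induction N with
  | zero => simp [queryCount]
  | succ N ih =>
    rw [Text.flatMap_range_succ, queryCount_append, ih fun i hi => h i (by omega), h N (by omega),
      Nat.succ_mul]

theorem queryCount_X (w : ℕ) : queryCount ([.X w] : Circuit a b) = 0 := rfl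

theorem queryCount_cnot (c t : ℕ) : queryCount (cnot c t : Circuit a b) = 0 := by
  unfold cnot
  split_ifs <;> rfl

theorem queryCount_ccnot (c d t : ℕ) : queryCount (ccnot c d t : Circuit a b) = 0 := by
  unfold ccnot
  split_ifs <;> rfl

theorem queryCount_eqStep (u v c d : ℕ) : queryCount (eqStep u v c d : Circuit a b) = 0 := by
  simp only [eqStep, queryCount_append, queryCount_cnot, queryCount_ccnot, queryCount_X]

theorem queryCount_pairCheck (i j s : ℕ) : queryCount (pairCheck i j s : Circuit a b) = 0 := by
  simp only [pairCheck, andNotStep, queryCount_append, queryCount_ccnot, queryCount_X,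
    queryCount_flatMap fun k _ => queryCount_eqStep _ _ _ _, mul_zero, add_zero]

theorem succ_mul_le {i p : ℕ} (c : ℕ) (hi : i < p) : i * c + c ≤ p * c := by
  rw [← Nat.succ_mul]; exact Nat.mul_le_mul_right c hi

/-- A description starts with the query count, so the printer needs the exact number. The bound on
`B` ensures that no `queryAt` degenerates to the empty circuit. -/
theorem queryCount_verifier {p B : ℕ} (hB : p * a + p * b ≤ B) :
    queryCount (verifier p B : Circuit a b) = p := by
  have h1 : ∀ i, i < p → queryCount (queryAt (i * a) (B + i * b) : Circuit a b) = 1 :=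
    fun i hi => by
      rw [queryAt_eq (by have := succ_mul_le a hi; omega)]; rfl
  have h2 : ∀ i, i < p → queryCount ((List.range i).flatMap (fun j => pairCheck i j
      (rowWire a b p B i + j * (a + 2))) ++ cnot (rowWire a b p B i + i * (a + 2))
        (rowWire a b p B (i + 1)) : Circuit a b) = 0 := fun i _ => by
    rw [queryCount_append, queryCount_cnot,
      queryCount_flatMap fun k _ => queryCount_pairCheck _ _ _, mul_zero]
  rw [verifier, checker]
  simp only [queryCount_append, queryCount_cnot, queryCount_X, queryCount_flatMap h1,
    queryCount_flatMap h2, queryCount_flatMap fun k _ => queryCount_eqStep _ _ _ _]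
  simp

/-! ### Printing the verifier -/

namespace Expr

instance : Add Expr := ⟨add⟩

instance : Mul Expr := ⟨mul⟩

end Expr

open Text QMac.Expr

/-- Prints a NOT gate. -/
def textX (w : Expr) : Text := app (nat (const 0)) (nat w)

/-- Prints a controlled-not gate. -/
def textCnot (c t : Expr) : Text := app (nat (const 3)) (app (nat c) (nat t))

/-- Prints a Toffoli gate. -/
def textCcnot (c d t : Expr) : Text := app (nat (const 4)) (app (nat c) (app (nat d) (nat t)))

/-- Prints a query gate whose registers are intervals, where `k` variables are in use. -/
def textQuery (k : ℕ) (x y : Expr) : Text :=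
  app (nat (const 5)) (app (loop (var 1) (nat (x + var k))) (loop (var 2) (nat (y + var k))))

/-- Prints `eqStep`. -/
def textEq (u v c d : Expr) : Text :=
  app (textCnot u v) (app (textX v) (app (textCcnot c v d) (app (textX v) (textCnot u v))))

theorem flatMap_code_X (w : ℕ) :
    ([.X w] : Circuit a b).flatMap Gate.code = natCode 0 ++ natCode w := by
  simp [Gate.code]

theorem flatMap_code_cnot {c t : ℕ} (h : c ≠ t) :
    (cnot c t : Circuit a b).flatMap Gate.code = natCode 3 ++ (natCode c ++ natCode t) := by
  simp [cnot, h, Gate.code]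

theorem flatMap_code_ccnot {c d t : ℕ} (h : c ≠ d ∧ c ≠ t ∧ d ≠ t) :
    (ccnot c d t : Circuit a b).flatMap Gate.code =
      natCode 4 ++ (natCode c ++ (natCode d ++ natCode t)) := by
  simp [ccnot, h, Gate.code]

theorem flatten_ofFn {α : Type} (n : ℕ) (g : ℕ → List α) :
    (List.ofFn fun i : Fin n => g i).flatten = (List.range n).flatMap g := by
  rw [List.flatMap_def, ← List.map_coe_finRange_eq_range, List.map_map, List.ofFn_eq_map]
  rfl

theorem flatMap_code_queryAt {x y : ℕ} (h : x + a ≤ y) :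
    (queryAt x y : Circuit a b).flatMap Gate.code = natCode 5 ++
      ((List.range a).flatMap (fun i => natCode (x + i)) ++
        (List.range b).flatMap fun j => natCode (y + j)) := by
  rw [queryAt_eq h, ← flatten_ofFn, ← flatten_ofFn]
  simp only [List.flatMap_cons, List.flatMap_nil, List.append_nil, Gate.code, List.append_assoc]
  rfl

variable {k : ℕ} {ρ : ℕ → ℕ}

theorem eval_textEq {U V C D : Expr} {u v c d : ℕ} (hU : U.eval ρ = u) (hV : V.eval ρ = v)
    (hC : C.eval ρ = c) (hD : D.eval ρ = d) (huv : u ≠ v) (h : c ≠ v ∧ c ≠ d ∧ v ≠ d) :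
    (textEq U V C D).eval k ρ = (eqStep u v c d : Circuit a b).flatMap Gate.code := by
  subst hU hV hC hD
  simp only [eqStep, List.flatMap_append, flatMap_code_X, flatMap_code_cnot huv,
    flatMap_code_ccnot h]
  rfl

theorem flatMap_congr_range {α : Type} {N : ℕ} {F G : ℕ → List α} (h : ∀ i, i < N → F i = G i) :
    (List.range N).flatMap F = (List.range N).flatMap G :=
  List.flatMap_congr fun i hi => h i (List.mem_range.mp hi)

/-- Prints `pairCheck`, where the six variables `q, a, b, L, i, j` are in use. -/
def textPair (s : Expr) : Text :=
  app (textX (s + const 1)) (app (loop (var 1) (textEq (var 4 * var 1 + var 6)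
    (var 5 * var 1 + var 6) (s + const 1 + var 6) (s + const 2 + var 6)))
    (app (textX (s + const 1 + var 1)) (app (textCcnot s (s + const 1 + var 1)
      (s + var 1 + const 2)) (textX (s + const 1 + var 1)))))

/-- Variable `6` counts the message bits; `hS'` says that the start wire does not depend on it. -/
theorem eval_textPair {S : Expr} {s i j : ℕ} (h1 : ρ 1 = a) (h4 : ρ 4 = i) (h5 : ρ 5 = j)
    (hS : S.eval ρ = s) (hS' : ∀ k, S.eval (Function.update ρ 6 k) = s) (hji : j < i)
    (his : i * a + a ≤ s) :
    (textPair S).eval 6 ρ = (pairCheck i j s : Circuit a b).flatMap Gate.code := by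
  have hja := succ_mul_le a hji
  have hloop : ∀ k, k < a → (textEq (var 4 * var 1 + var 6)
      (var 5 * var 1 + var 6) (S + const 1 + var 6) (S + const 2 + var 6)).eval 7
        (Function.update ρ 6 k) = (eqStep (i * a + k) (j * a + k) (s + 1 + k)
          (s + 2 + k) : Circuit a b).flatMap Gate.code := fun k hk => by
    refine eval_textEq ?_ ?_ ?_ ?_ (by omega) ⟨by omega, by omega, by omega⟩
    · change ρ 4 * ρ 1 + k = _; rw [h4, h1]
    · change ρ 5 * ρ 1 + k = _; rw [h5, h1]
    · change S.eval _ + 1 + k = _; rw [hS']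
    · change S.eval _ + 2 + k = _; rw [hS']
  simp only [pairCheck, andNotStep, List.flatMap_append, flatMap_code_X, List.flatMap_assoc,
    ← flatMap_congr_range hloop,
    flatMap_code_ccnot (show s ≠ s + 1 + a ∧ s ≠ s + a + 2 ∧ s + 1 + a ≠ s + a + 2 by omega)]
  subst hS h1
  rfl

/-- The number of pairs. -/
def exprP : Expr := var 0 + const 1

/-- The first wire of the work space. -/
def exprB : Expr := var 3 + exprP * (var 1 + var 2)

/-- The wire `rowWire a b p B i`. -/
def exprRow (i : Expr) : Expr :=
  exprB + exprP * var 2 + exprP * var 2 + i * (exprP * (var 1 + const 2) + const 1)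

/-- Prints the verifier. -/
def verifierText : Text :=
  app (app (loop exprP (textQuery 5 (var 4 * var 1) (exprB + var 4 * var 2)))
    (app (textX (exprB + exprP * var 2))
    (app (loop (exprP * var 2) (textEq (exprP * var 1 + var 4) (exprB + var 4)
      (exprB + exprP * var 2 + var 4) (exprB + exprP * var 2 + var 4 + const 1)))
    (loop exprP (app (loop (var 4) (textPair (exprRow (var 4) + var 5 * (var 1 + const 2))))
      (textCnot (exprRow (var 4) + var 4 * (var 1 + const 2)) (exprRow (var 4 + const 1))))))))
  (app (textCnot (const 0) (exprRow exprP)) (textCnot (exprRow exprP) (const 0)))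

theorem verifierText_scoped : verifierText.Scoped 4 := by
  simp [verifierText, textQuery, textX, textEq, textCnot, textCcnot, textPair, exprRow, exprB,
    exprP, Text.Scoped, Expr.Scoped]

/-- The expressions reduce to the intended wire numbers by computation. What needs proof is that the
wires of each gate are distinct, so that no gate is dropped; `0 < L` keeps the verdict wire away
from wire `0`. -/
theorem eval_verifierText (q a b L : ℕ) (hL : 0 < L) :
    verifierText.eval 4 (params q a b L) =
      (verifier (q + 1) (L + (q + 1) * (a + b)) : Circuit a b).flatMap Gate.code := by
  set p := q + 1 with hp
  set B := L + p * (a + b) with hBdef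
  have hB : p * a + p * b < B := by rw [hBdef, Nat.mul_add]; omega
  have hrow : ∀ i, B + p * b + p * b ≤ rowWire a b p B i := fun i => Nat.le_add_right _ _
  have h1 : ∀ i, i < p → (textQuery 5 (var 4 * var 1) (exprB + var 4 * var 2)).eval 5
      (Function.update (params q a b L) 4 i) =
        (queryAt (i * a) (B + i * b) : Circuit a b).flatMap Gate.code := fun i hi => by
    rw [flatMap_code_queryAt (by have := succ_mul_le a hi; omega)]
    rfl
  have h2 : ∀ k, k < p * b → (textEq (exprP * var 1 + var 4) (exprB + var 4)
      (exprB + exprP * var 2 + var 4) (exprB + exprP * var 2 + var 4 + const 1)).eval 5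
      (Function.update (params q a b L) 4 k) = (eqStep (p * a + k) (B + k) (B + p * b + k)
        (B + p * b + k + 1) : Circuit a b).flatMap Gate.code := fun k hk =>
    eval_textEq rfl rfl rfl rfl (by omega) (by omega)
  have h3 : ∀ i, i < p → (app (loop (var 4) (textPair (exprRow (var 4) + var 5 *
      (var 1 + const 2)))) (textCnot (exprRow (var 4) + var 4 * (var 1 + const 2))
        (exprRow (var 4 + const 1)))).eval 5 (Function.update (params q a b L) 4 i) =
      ((List.range i).flatMap (fun j => pairCheck i j (rowWire a b p B i + j * (a + 2))) ++
        cnot (rowWire a b p B i + i * (a + 2)) (rowWire a b p B (i + 1)) :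
          Circuit a b).flatMap Gate.code := fun i hi => by
    have h4 : ∀ j, j < i → (textPair (exprRow (var 4) + var 5 * (var 1 + const 2))).eval 6
        (Function.update (Function.update (params q a b L) 4 i) 5 j) =
          (pairCheck i j (rowWire a b p B i + j * (a + 2)) : Circuit a b).flatMap Gate.code :=
      fun j hj => eval_textPair rfl rfl rfl rfl (fun _ => rfl) hj
        (by have := succ_mul_le a hi; have := hrow i; omega)
    have h5 : rowWire a b p B i + i * (a + 2) ≠ rowWire a b p B (i + 1) := by
      have := succ_mul_le (a + 2) hi
      have : (i + 1) * (p * (a + 2) + 1) = i * (p * (a + 2) + 1) + (p * (a + 2) + 1) :=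
        Nat.succ_mul _ _
      unfold rowWire
      omega
    simp only [List.flatMap_append, List.flatMap_assoc, ← flatMap_congr_range h4,
      flatMap_code_cnot h5]
    rfl
  have h6 : 0 ≠ rowWire a b p B p := by have := hrow p; omega
  rw [verifier, checker]
  iterate 5 rw [List.flatMap_append]
  rw [List.flatMap_assoc, List.flatMap_assoc, List.flatMap_assoc,
    ← flatMap_congr_range h1, ← flatMap_congr_range h2, ← flatMap_congr_range h3,
    flatMap_code_X, flatMap_code_cnot h6, flatMap_code_cnot h6.symm]
  rfl

end Verifier

/-! ### Sizes -/

section Sizes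

variable {a b : ℕ}

theorem length_natCode (m : ℕ) : (natCode m).length = m + 1 := by simp [natCode]

theorem Gate.Below.mono {V W : ℕ} {g : Gate a b} (h : g.Below V) (hVW : V ≤ W) : g.Below W := by
  cases g <;> simp only [Gate.Below] at h ⊢
  case query => exact ⟨fun i => (h.1 i).trans_le hVW, fun j => (h.2 j).trans_le hVW⟩
  all_goals omega

theorem lt_length_flatten_ofFn {w : ℕ} (r : Fin w → ℕ) (i : Fin w) :
    r i < (List.ofFn fun i => natCode (r i)).flatten.length := by
  have h : natCode (r i) ∈ List.ofFn fun i => natCode (r i) := List.mem_ofFn.mpr ⟨i, rfl⟩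
  have := (List.sublist_flatten_of_mem h).length_le
  rw [length_natCode] at this
  omega

/-- Wire numbers are written in unary, so a description is longer than any wire number in it. -/
theorem Gate.below_length_code (g : Gate a b) : g.Below g.code.length := by
  cases g with
  | query x y h =>
    refine ⟨fun i => ?_, fun j => ?_⟩
    · have := lt_length_flatten_ofFn x i
      simp only [Gate.code, List.length_append]
      omega
    · have := lt_length_flatten_ofFn y j
      simp only [Gate.code, List.length_append]
      omega
  | _ =>
    simp only [Gate.Below, Gate.code, List.length_append, length_natCode]
    omega

theorem below_length_circuitCode (C : Circuit a b) :
    ∀ g ∈ C, g.Below (circuitCode C).length := fun g hg => by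
  refine g.below_length_code.mono ?_
  have := (List.sublist_flatten_of_mem (List.mem_map_of_mem (f := Gate.code) hg)).length_le
  rw [circuitCode, List.length_append]
  omega

/-- The query count is also written in unary. This bounds `q` polynomially and makes `L` positive.
-/
theorem queryCount_lt_length_circuitCode (C : Circuit a b) :
    queryCount C < (circuitCode C).length := by
  rw [circuitCode, List.length_append, length_natCode]
  omega

end Sizes

/-! ### Negligible functions -/

theorem IsNegligible.add {ε δ : ℕ → ℝ} (hε : IsNegligible ε) (hδ : IsNegligible δ) :
    IsNegligible fun n => ε n + δ n := by
  refine ⟨fun n => add_pos (hε.1 n) (hδ.1 n), fun c _ => ?_⟩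
  -- The additional factor `1/n ≤ 1/2` absorbs the two summands.
  obtain ⟨M, hM⟩ := hε.2 (c + 1) (by omega)
  obtain ⟨N, hN⟩ := hδ.2 (c + 1) (by omega)
  refine ⟨M + N + 1, fun n hn => ?_⟩
  have h1 := hM n (by omega)
  have h2 := hN n (by omega)
  have hn2 : (2 : ℝ) ≤ n := by exact_mod_cast (by omega : 2 ≤ n)
  have hpos : (0 : ℝ) < (n : ℝ) ^ c := by positivity
  have h3 : 1 / (n : ℝ) ^ (c + 1) ≤ 1 / (n : ℝ) ^ c / 2 := by
    rw [div_div, pow_succ]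
    exact one_div_le_one_div_of_le (by positivity) (by gcongr)
  linarith

theorem eval_le_mul_pow (P : Polynomial ℕ) {n : ℕ} (hn : 1 ≤ n) :
    P.eval n ≤ P.eval 1 * n ^ P.natDegree := by
  rw [Polynomial.eval_eq_sum_range, Polynomial.eval_eq_sum_range, Finset.sum_mul]
  refine Finset.sum_le_sum fun i hi => ?_
  rw [one_pow, mul_one]
  exact Nat.mul_le_mul_left _ (Nat.pow_le_pow_right hn (by simpa [Nat.lt_succ_iff] using hi))

theorem IsNegligible.polynomial_mul {ε : ℕ → ℝ} (hε : IsNegligible ε) (P : Polynomial ℕ)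
    (hP : ∀ n, 0 < P.eval n) : IsNegligible fun n => ((P.eval n : ℕ) : ℝ) * ε n := by
  refine ⟨fun n => mul_pos (by exact_mod_cast hP n) (hε.1 n), fun c _ => ?_⟩
  obtain ⟨N, hN⟩ := hε.2 (c + (P.natDegree + 1)) (by omega)
  -- Beyond this threshold `n` exceeds `P.eval 1`, the sum of the coefficients, so that `P.eval n ≤
  -- n ^ (P.natDegree + 1)`.
  refine ⟨N + P.eval 1, fun n hn => ?_⟩
  have h1 : P.eval n ≤ n ^ (P.natDegree + 1) :=
    calc P.eval n ≤ P.eval 1 * n ^ P.natDegree := eval_le_mul_pow P (by omega)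
      _ ≤ n * n ^ P.natDegree := Nat.mul_le_mul_right _ (by omega)
      _ = _ := (pow_succ' n _).symm
  have hn0 : (0 : ℝ) < n := by exact_mod_cast (by omega : 0 < n)
  calc ((P.eval n : ℕ) : ℝ) * ε n ≤ (n : ℝ) ^ (P.natDegree + 1) * ε n := by
        refine mul_le_mul_of_nonneg_right ?_ (hε.1 n).le
        exact_mod_cast h1
    _ < (n : ℝ) ^ (P.natDegree + 1) * (1 / (n : ℝ) ^ (c + (P.natDegree + 1))) :=
        mul_lt_mul_of_pos_left (hN n (by omega)) (by positivity)
    _ = 1 / (n : ℝ) ^ c := by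
        rw [pow_add (n : ℝ) c]
        field_simp

/-! ### From a forger to a distinguisher -/

/-- The number of the first wire of the work space of the distinguisher. -/
def workWire {a b : ℕ} (C : Circuit a b) : ℕ :=
  (circuitCode C).length + (queryCount C + 1) * (a + b)

/-- Runs the forger, and checks its output. -/
def distinguisher {a b : ℕ → ℕ} (A : QPTAlgorithm a b) (ha : PolyTimeLength a)
    (hb : PolyTimeLength b) : QPTAlgorithm a b where
  circuit n := A.circuit n ++ verifier (queryCount (A.circuit n) + 1) (workWire (A.circuit n))
  uniform := by
    -- The new leading number is `q + (q + 1)`: the queries of the forger and one query for each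
    -- pair.
    have := polyTime_extend (q := fun n => queryCount (A.circuit n))
      (G := fun n => ((A.circuit n).map Gate.code).flatten) A.uniform ha hb
      (.add (.var 0) (.add (.var 0) (.const 1))) (by simp [Expr.Scoped])
      verifierText verifierText_scoped
    convert this using 2 with n
    rw [circuitCode, queryCount_append, queryCount_verifier, List.map_append, List.flatten_append]
    · congr 2
      rw [← List.flatMap_def]
      refine (eval_verifierText _ _ _ _ ?_).symm
      exact (Nat.zero_le _).trans_lt (queryCount_lt_length_circuitCode _)
    · rw [workWire, ← Nat.mul_add]
      omega

/-- The distinguisher succeeds if and only if the forger does. -/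
theorem outcomeProb_distinguisher {a b : ℕ → ℕ} (conv : QueryConvention) (A : QPTAlgorithm a b)
    (ha : PolyTimeLength a) (hb : PolyTimeLength b) (n : ℕ) (g : BitVec (a n) → BitVec (b n)) :
    outcomeProb conv g ((distinguisher A ha hb).circuit n) (fun S => 0 ∈ S) =
      outcomeProb conv g (A.circuit n) fun S =>
        Function.Injective (outputPair (a n) (b n) (queryCount (A.circuit n) + 1) S) ∧
          ∀ i, g (outputPair (a n) (b n) (queryCount (A.circuit n) + 1) S i).1 =
            (outputPair (a n) (b n) (queryCount (A.circuit n) + 1) S i).2 := by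
  have h0 := queryCount_lt_length_circuitCode (A.circuit n)
  refine (outcomeProb_append conv g _ _ (verifier_isClassical _ _) _).trans
    (outcomeProb_congr conv g (below_length_circuitCode _) fun S hS => ?_)
  refine zero_mem_runPerm_verifier ?_ ?_ (hS.mono ?_)
  · rw [workWire, ← Nat.mul_add]; omega
  · rw [workWire]; omega
  · rw [workWire]; omega

/-- `Gen` returns its coins, so both sides average over the same uniform key and the equality is
exact. -/
theorem forgeProb_eq_realProb (conv : QueryConvention) (f : KeyedFunction)
    (ha : PolyTimeLength f.inLen) (hb : PolyTimeLength f.outLen)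
    (A : QPTAlgorithm f.inLen f.outLen) (n : ℕ) :
    f.toMAC.forgeProb conv A n = f.realProb conv (distinguisher A ha hb) n := by
  unfold KeyedFunction.realProb MAC.forgeProb
  simp only [outcomeProb_distinguisher]
  refine congrArg (· / _) (Finset.sum_congr rfl fun k _ => congrArg _ (funext fun S => ?_))
  exact propext (and_congr_right fun _ => forall_congr' fun i =>
    decide_eq_true_iff (p := f.eval n k (outputPair (f.inLen n) (f.outLen n) _ S i).1 =
      (outputPair (f.inLen n) (f.outLen n) _ S i).2))

/-- The checking queries are absorbed into the event by `outcomeProb_distinguisher`, so only the `q`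
queries of the forger count against the `q + 1` pairs. -/
theorem idealProb_distinguisher_le (conv : QueryConvention) (f : KeyedFunction)
    (ha : PolyTimeLength f.inLen) (hb : PolyTimeLength f.outLen)
    (A : QPTAlgorithm f.inLen f.outLen) (n : ℕ) :
    f.idealProb conv (distinguisher A ha hb) n ≤
      (queryCount (A.circuit n) + 1 : ℕ) * (1 / (Fintype.card (BitVec (f.outLen n)) : ℝ)) := by
  unfold KeyedFunction.idealProb
  simp only [outcomeProb_distinguisher]
  rw [div_le_iff₀ (Nat.cast_pos.mpr Fintype.card_pos), mul_one_div]
  exact sum_outcomeProb_le (A.circuit n) _ _ (below_length_circuitCode _) (Nat.lt_succ_self _) _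

theorem KeyedFunction.toMAC_isEUFqCMA {conv : QueryConvention} {f : KeyedFunction}
    (hf : f.IsQuantumPRF conv)
    (hY : IsNegligible fun n => 1 / (Fintype.card (BitVec (f.outLen n)) : ℝ)) :
    f.toMAC.IsEUFqCMA conv := by
  intro A
  have ha := hf.1.2.1
  have hb := hf.1.2.2.1
  obtain ⟨negl, hnegl, hD⟩ := hf.2 (distinguisher A ha hb)
  obtain ⟨P, hP⟩ := A.uniform.length_le
  -- `P` already bounds `q + 1`; the added `1` makes the positivity required by `polynomial_mul`
  -- evident.
  refine ⟨_, (hY.polynomial_mul (P + 1) fun n => by simp).add hnegl, fun n => ?_⟩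
  have h1 := forgeProb_eq_realProb conv f ha hb A n
  have h2 := idealProb_distinguisher_le conv f ha hb A n
  have h3 := le_of_abs_le (hD n)
  have h4 : queryCount (A.circuit n) + 1 ≤ (P + 1).eval n := by
    have := hP n
    have := queryCount_lt_length_circuitCode (A.circuit n)
    simp only [List.map_cons, List.map_nil, List.sum_cons, List.sum_nil, length_ones,
      Nat.add_zero, Polynomial.eval_add, Polynomial.eval_one] at *
    omega
  have h5 : ((queryCount (A.circuit n) + 1 : ℕ) : ℝ) *
      (1 / (Fintype.card (BitVec (f.outLen n)) : ℝ)) ≤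
        (((P + 1).eval n : ℕ) : ℝ) * (1 / (Fintype.card (BitVec (f.outLen n)) : ℝ)) :=
    mul_le_mul_of_nonneg_right (by exact_mod_cast h4) (hY.1 n).le
  calc f.toMAC.forgeProb conv A n = f.realProb conv (distinguisher A ha hb) n := h1
    _ ≤ f.idealProb conv (distinguisher A ha hb) n + negl n := by linarith
    _ ≤ _ := add_le_add (h2.trans h5) le_rfl

end QMac

theorem mainTheorem4 (conv : QMac.QueryConvention) (f : QMac.KeyedFunction)
    (hf : f.IsQuantumPRF conv)
    (hY : QMac.IsNegligible fun n => 1 / (Fintype.card (BitVec (f.outLen n)) : ℝ)) :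
    f.toMAC.IsMAC ∧ f.toMAC.IsEUFqCMA conv :=
  ⟨QMac.KeyedFunction.toMAC_isMAC hf.1, QMac.KeyedFunction.toMAC_isEUFqCMA hf hY⟩
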